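/- Let $\Gamma$ be a subgroup of finite index in $\mathrm{SL}_2(\mathbb Z)$ and let $f$ be a cusp form of real weight $r>2$ for $\Gamma$ with a unimodular multiplier system $\{\mu_\gamma\}$: $f$ is holomorphic on the upper half-plane $\mathbb H$, $f(\gamma z)=\mu_\gamma (cz+d)^r f(z)$ with $|\mu_\gamma|=1$ for all $\gamma=\left(\begin{smallmatrix}a&b\\c&d\end{smallmatrix}\right)\in\Gamma$, $f$ has at most polynomial growth as $\operatorname{Im} z\to0^+$, and $f$ is cuspidal at every cusp in $\mathbb Q\cup\{\infty\}$ (see below). All powers and logarithms use $-\pi<\arg\le\pi$. The width of a cusp is the order of its stabilizer in $\mathrm{SL}_2(\mathbb Z)$ modulo $\Gamma$, with $\gamma$ and $-\gamma$ identified. A scaling matrix for a cusp $\mathfrak a$ of width $m_{\mathfrak a}$ is $\sigma=\gamma\left(\begin{smallmatrix}\sqrt{m_{\mathfrak a}}&0\\0&1/\sqrt{m_{\mathfrak a}}\end{smallmatrix}\right)$, where $\gamma\in\mathrm{SL}_2(\mathbb Z)$, $\gamma(\infty)=\mathfrak a$, and the bottom row $(c,d)$ of $\gamma$ has $c<0$,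 or $c=0$ and $d=1$. Put $f^\sigma(z)=f(\sigma z)/j_\sigma(z)^r$, where $j_\sigma(z)$ is the product of the bottom row of $\sigma$ with $(z,1)^T$, and write $f^\sigma(z)=\sum_{n\ge0}a_n^\sigma e^{2\pi i(n+\kappa_{\mathfrak a})z}$ with $0\le\kappa_{\mathfrak a}<1$; $f$ is cuspidal at $\mathfrak a$ if $\kappa_{\mathfrak a}>0$ or $a_0^\sigma=0$, and then $f(\mathfrak a)=0$. Let $m$ be the width of $\infty$ and write $f(mz)=\sum_{n\ge0}a_ne^{2\pi i(n+\kappa)z}$ with $0\le\kappa<1$. Let $\alpha=r-1$, let $x_0\in\mathbb Q$ and let $\sigma$ be any scaling matrix for $x_0$. Then the series $$f_\alpha(x)=\sum_{n+\kappa>0}\frac{a_n}{(n+\kappa)^\alpha}e^{2\pi i(n+\kappa)x/m},\qquad f^\sigma_\alpha(x)=\sum_{n+\kappa_{x_0}>0}\frac{a_n^\sigma}{(n+\kappa_{x_0})^\alpha}e^{2\pi i(n+\kappa_{x_0})x}$$ converge (as limits of partial sums) for every real $x$, and there are real constants $A\neq0$ and $B>0$ such that the error term $E$ in the approximate functional equation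 $$f_\alpha(x)=A\,i^{-\alpha}f(x_0)\,\psi(x-x_0)+B\,|x-x_0|^{2\alpha}(x-x_0)^{-r}f^\sigma_\alpha(\sigma^{-1}x)+E(x)\qquad(x\in\mathbb R)$$ is given for every $x\in\mathbb R$ by $$E(x)=\frac{(2\pi)^{r-1}}{(im)^{r-1}\,\Gamma(r-1)}\int_{(x_0)}(z-x)^{r-2}f(z)\,dz,$$ where $(x_0)$ is the vertical ray from $x_0$ to $i\infty$ and the integral converges absolutely. Here $\psi(x)=x^{\alpha-r}$ if $\alpha-r\notin\mathbb Z$ and $\psi(x)=x^{\alpha-r}\log x$ if $\alpha-r\in\mathbb Z$; the term with $A$ is zero since $f(x_0)=0$, and at $x=x_0$ the term with $B$ is read as its limit $0$. If moreover $r$ is an integer, then $E$ is a polynomial in $x$, of degree at most $r-2$ (the Eichler–Shimura period polynomial, up to a constant factor). -/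

import Mathlib

open scoped MatrixGroups

noncomputable section

namespace FracModular

open UpperHalfPlane Matrix MeasureTheory

/-- The automorphy factor `j_g(z) = c z + d` of a real unimodular matrix `g = (a, b; c, d)`. -/
def autFactor (g : SL(2, ℝ)) (z : ℍ) : ℂ :=
  ((g 1 0 : ℝ) : ℂ) * (z : ℂ) + ((g 1 1 : ℝ) : ℂ)

/-- The slash operator `f^g(z) = f(g z) / j_g(z) ^ r` for a matrix `g` of determinant one. The
power uses the branch of the argument in `(-π, π]`. -/
def slash (r : ℝ) (g : SL(2, ℝ)) (f : ℍ → ℂ) (z : ℍ) : ℂ :=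
  f (g • z) / autFactor g z ^ (r : ℂ)

/-- An integral matrix regarded as a real one. -/
def toReal (γ : SL(2, ℤ)) : SL(2, ℝ) := SpecialLinearGroup.map (Int.castRingHom ℝ) γ

/-- `f` is a modular form of real weight `r` for the group `Γ` and the multiplier system `mu`:
it is holomorphic on the upper half-plane, satisfies the transformation law with unimodular
multipliers, and has at most polynomial growth as the imaginary part tends to `0` from above. -/
structure IsModularForm (Γ : Subgroup SL(2, ℤ)) (r : ℝ) (mu : SL(2, ℤ) → ℂ) (f : ℍ → ℂ) :
    Prop where
  holo : DifferentiableOn ℂ (f ∘ ofComplex) {z : ℂ | 0 < z.im}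
  unimodular : ∀ γ ∈ Γ, ‖mu γ‖ = 1
  law : ∀ γ ∈ Γ, ∀ z : ℍ, f (γ • z) = mu γ * autFactor (toReal γ) z ^ (r : ℂ) * f z
  growth : ∃ C K δ : ℝ, 0 < δ ∧ ∀ z : ℍ, z.im < δ → ‖f z‖ ≤ C * z.im ^ (-K)

/-- The stabilizer in `SL(2, ℤ)` of a cusp, that is, of an element of `ℚ ∪ {∞}`. -/
def cuspStabilizer (𝔞 : OnePoint ℚ) : Subgroup SL(2, ℤ) :=
  (MulAction.stabilizer (GL (Fin 2) ℚ) 𝔞).comap (SpecialLinearGroup.mapGL ℚ)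

/-- The width of the cusp `𝔞` for `Γ`: the order of the stabilizer of `𝔞` modulo `Γ`, matrices
being identified with the Möbius transformations they induce (so `γ` and `-γ` are identified). -/
def cuspWidth (Γ : Subgroup SL(2, ℤ)) (𝔞 : OnePoint ℚ) : ℕ :=
  (Γ ⊔ Subgroup.zpowers (-1)).relIndex (cuspStabilizer 𝔞)

/-- `σ` is a scaling matrix for the cusp `𝔞`: `σ = γ η`, where `γ ∈ SL(2, ℤ)` sends `∞` to `𝔞`,
its bottom row `(c, d)` satisfies `c < 0`, or `c = 0` and `d = 1`, and
`η = (√m, 0; 0, 1 / √m)` with `m` the width of `𝔞`. -/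
def IsScalingMatrix (Γ : Subgroup SL(2, ℤ)) (𝔞 : OnePoint ℚ) (σ : SL(2, ℝ)) : Prop :=
  ∃ γ : SL(2, ℤ),
    SpecialLinearGroup.mapGL ℚ γ • (OnePoint.infty : OnePoint ℚ) = 𝔞 ∧
    (γ 1 0 < 0 ∨ (γ 1 0 = 0 ∧ γ 1 1 = 1)) ∧
    (σ : Matrix (Fin 2) (Fin 2) ℝ) = (toReal γ : Matrix (Fin 2) (Fin 2) ℝ) *
      !![√(cuspWidth Γ 𝔞 : ℝ), 0; 0, 1 / √(cuspWidth Γ 𝔞 : ℝ)]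

/-- The parameter `κ ∈ [0, 1)` of a function satisfying `g (z + 1) = exp (2 π i κ) g z`.
It is unique when `g` is not the zero function. -/
def cuspParam (g : ℍ → ℂ) : ℝ :=
  Classical.epsilon fun κ : ℝ => 0 ≤ κ ∧ κ < 1 ∧
    ∀ z : ℍ, g ((1 : ℝ) +ᵥ z) = Complex.exp (2 * Real.pi * Complex.I * κ) * g z

/-- The coefficient `a_n` in `g z = ∑ a_n exp (2 π i (n + κ) z)`, as the integral
`∫ g z exp (-2 π i (n + κ) z) dz` over the segment from `i` to `1 + i`. -/
def fourierCoef (g : ℍ → ℂ) (n : ℕ) : ℂ :=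
  ∫ x in (0 : ℝ)..1, g (ofComplex (x + Complex.I)) *
    Complex.exp (-(2 * Real.pi * Complex.I * (n + cuspParam g : ℝ) * (x + Complex.I)))

/-- The value at the cusp `∞` of a function with a Fourier expansion as above: zero when it is
cuspidal there, i.e. if `κ > 0` or `a_0 = 0`, and `a_0` otherwise. For `g = slash r σ f` with `σ` a
scaling matrix for `𝔞`, this is the value `f(𝔞)`. -/
def valueAtInfty (g : ℍ → ℂ) : ℂ := if 0 < cuspParam g then 0 else fourierCoef g 0

/-- A cusp form is a modular form that is cuspidal at every cusp `𝔞`, that is, whose expansion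
at `𝔞` has `κ > 0` or `a_0 = 0`. -/
structure IsCuspForm (Γ : Subgroup SL(2, ℤ)) (r : ℝ) (mu : SL(2, ℤ) → ℂ) (f : ℍ → ℂ) : Prop
    extends IsModularForm Γ r mu f where
  cuspidal : ∀ (𝔞 : OnePoint ℚ) (σ : SL(2, ℝ)), IsScalingMatrix Γ 𝔞 σ →
    0 < cuspParam (slash r σ f) ∨ fourierCoef (slash r σ f) 0 = 0

/-- The function `z ↦ g (m z)`. -/
def dilate (m : ℕ) (g : ℍ → ℂ) (z : ℍ) : ℂ := g (ofComplex ((m : ℂ) * z))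

/-- The partial sum over `0 ≤ n < N`, `n + κ > 0`, of the series
`∑ a_n / (n + κ) ^ α * exp (2 π i (n + κ) x / m)`, where
`g (m z) = ∑ a_n exp (2 π i (n + κ) z)`. -/
def fracPartialSum (m : ℕ) (g : ℍ → ℂ) (α : ℝ) (N : ℕ) (x : ℝ) : ℂ :=
  ∑ n ∈ Finset.range N,
    if 0 < (n : ℝ) + cuspParam (dilate m g) then
      fourierCoef (dilate m g) n / (((n + cuspParam (dilate m g)) ^ α : ℝ) : ℂ) *
        Complex.exp (2 * Real.pi * Complex.I * (n + cuspParam (dilate m g) : ℝ) * (x / m))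
    else 0

/-- The `α`-fractional integral `g_α` of a function whose cusp `∞` has width `m`: the sum of the
(possibly only conditionally convergent) series whose partial sums are `fracPartialSum`. -/
def fracIntegral (m : ℕ) (g : ℍ → ℂ) (α : ℝ) (x : ℝ) : ℂ :=
  Filter.limUnder Filter.atTop fun N : ℕ => fracPartialSum m g α N x

/-- The Möbius action of a real matrix on a real number that is not its pole. -/
def moebius (g : SL(2, ℝ)) (x : ℝ) : ℝ := (g 0 0 * x + g 0 1) / (g 1 0 * x + g 1 1)

/-- `ψ(x) = x ^ (α - r)` if `α - r` is not an integer, and `x ^ (α - r) * log x` if it is. -/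
def psi (α r : ℝ) (x : ℝ) : ℂ :=
  open Classical in
  if ∃ k : ℤ, α - r = k then (x : ℂ) ^ ((α - r : ℝ) : ℂ) * Complex.log x
  else (x : ℂ) ^ ((α - r : ℝ) : ℂ)

/-- The error term `E(x)` in the approximate functional equation
`f_α(x) = A i^(-α) f(x₀) ψ(x - x₀) + B |x - x₀|^(2α) (x - x₀)^(-r) f_α^σ(σ⁻¹ x) + E(x)`.
For `α > 0` the second summand is `0` at `x = x₀`, where `σ⁻¹` has its pole. -/
def approxError (Γ : Subgroup SL(2, ℤ)) (r α : ℝ) (f : ℍ → ℂ) (x₀ : ℚ) (σ : SL(2, ℝ))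
    (A B : ℝ) (x : ℝ) : ℂ :=
  fracIntegral (cuspWidth Γ OnePoint.infty) f α x
    - (A * Complex.I ^ (-α : ℂ) * valueAtInfty (slash r σ f) * psi α r (x - x₀)
      + B * ((|x - x₀| ^ (2 * α) : ℝ) : ℂ) * ((x - x₀ : ℝ) : ℂ) ^ (-r : ℂ)
        * fracIntegral 1 (slash r σ f) α (moebius σ⁻¹ x))

/-- The integrand `(z - x) ^ (r - 2) f z dz` on the vertical ray `z = x₀ + i t`, `t > 0`. -/
def eichlerIntegrand (r : ℝ) (f : ℍ → ℂ) (x₀ x t : ℝ) : ℂ :=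
  ((x₀ + t * Complex.I) - x : ℂ) ^ ((r - 2 : ℝ) : ℂ) * f (ofComplex (x₀ + t * Complex.I))
    * Complex.I

/-- The Eichler integral `(2π)^(r-1) / ((i m)^(r-1) Γ(r-1)) ∫_(x₀) (z - x)^(r-2) f z dz` along the
vertical ray from `x₀` to `i∞`. -/
def periodIntegral (m : ℕ) (r : ℝ) (f : ℍ → ℂ) (x₀ x : ℝ) : ℂ :=
  (((2 * Real.pi) ^ (r - 1) : ℝ) : ℂ)
    / ((Complex.I * m) ^ ((r - 1 : ℝ) : ℂ) * ((Real.Gamma (r - 1) : ℝ) : ℂ))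
    * ∫ t in Set.Ioi (0 : ℝ), eichlerIntegrand r f x₀ x t

end FracModular

end

/- Up to a constant, `f_α(x)` is the Mellin transform of `f` along the vertical ray over `x`:
integrating the partial sums of the Fourier series against `t^(α-1)` gives the partial sums of
`f_α`, and `f = O(y^(-r/2))` controls them well enough for convergence as soon as `α > r/2`. For
`α = r - 1` this Mellin transform is the integral of `(z - x)^(r-2) f(z) dz` from `x` to `i∞`, up
to a power of `i`. The substitution `z = σ w` carries this form into a multiple of the same kind of
form for `f^σ` with base point `σ⁻¹x`. Hence `f_α(x)`, `f_α^σ(σ⁻¹x)` and `E(x)` are integrals of one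
form along the three sides of the ideal triangle with vertices `x`, `x₀` and `∞`, and the
functional equation is Cauchy's theorem. -/

open scoped Manifold Real Topology

noncomputable section

namespace FracModular

open UpperHalfPlane hiding I
open Matrix MeasureTheory Filter Asymptotics
open Complex (I)

/-! ### Twisted Fourier expansions -/

/-- The additive character `e(a z) = exp (2 π i a z)` of real frequency `a`. -/
def fourierExp (a : ℝ) (z : ℂ) : ℂ := Complex.exp (2 * π * I * a * z)

lemma fourierExp_add (a : ℝ) (z w : ℂ) :
    fourierExp a (z + w) = fourierExp a z * fourierExp a w := by
  rw [fourierExp, mul_add, Complex.exp_add, fourierExp, fourierExp]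

lemma fourierExp_freq_add (a b : ℝ) (z : ℂ) :
    fourierExp (a + b) z = fourierExp a z * fourierExp b z := by
  rw [fourierExp, Complex.ofReal_add, mul_add, add_mul, Complex.exp_add, fourierExp, fourierExp]

@[simp]
lemma fourierExp_freq_zero (z : ℂ) : fourierExp 0 z = 1 := by simp [fourierExp]

lemma fourierExp_natCast (n : ℕ) (z : ℂ) : fourierExp n z = fourierExp 1 z ^ n := by
  rw [fourierExp, fourierExp, ← Complex.exp_nat_mul]
  congr 1
  push_cast
  ring

lemma fourierExp_intCast_one (n : ℤ) : fourierExp n 1 = 1 :=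
  Complex.exp_eq_one_iff.2 ⟨n, by push_cast; ring⟩

lemma norm_fourierExp (a : ℝ) (z : ℂ) : ‖fourierExp a z‖ = Real.exp (-(2 * π * a * z.im)) := by
  rw [fourierExp, Complex.norm_exp]
  simp

lemma norm_fourierExp_le_one {a : ℝ} (ha : 0 ≤ a) {z : ℂ} (hz : 0 ≤ z.im) :
    ‖fourierExp a z‖ ≤ 1 := by
  rw [norm_fourierExp, Real.exp_le_one_iff, Left.neg_nonpos_iff]
  positivity

@[fun_prop]
lemma differentiable_fourierExp (a : ℝ) : Differentiable ℂ (fourierExp a) := by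
  unfold fourierExp
  fun_prop

@[fun_prop]
lemma continuous_fourierExp (a : ℝ) : Continuous (fourierExp a) :=
  (differentiable_fourierExp a).continuous

lemma coe_ofComplex_add_mul_I {x t : ℝ} (ht : 0 < t) :
    (ofComplex (x + t * I) : ℂ) = x + t * I :=
  congrArg _ (ofComplex_apply_of_im_pos (by simpa using ht))

lemma im_ofComplex_add_mul_I {x t : ℝ} (ht : 0 < t) : (ofComplex (x + t * I)).im = t := by
  rw [← coe_im, coe_ofComplex_add_mul_I ht]
  simp

lemma ofComplex_one_add_mul_I {x t : ℝ} (ht : 0 < t) :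
    ofComplex ((1 + x : ℝ) + t * I) = (1 : ℝ) +ᵥ ofComplex (x + t * I) := by
  apply UpperHalfPlane.ext
  rw [coe_vadd, coe_ofComplex_add_mul_I ht, coe_ofComplex_add_mul_I ht]
  push_cast
  ring

lemma continuousOn_comp_ofComplex {g : ℍ → ℂ} (hol : MDiff g) :
    ContinuousOn (g ∘ ofComplex) {z : ℂ | 0 < z.im} :=
  (UpperHalfPlane.mdifferentiable_iff.1 hol).continuousOn

lemma continuousOn_vertical {g : ℍ → ℂ} (hol : MDiff g) (x : ℝ) :
    ContinuousOn (fun t : ℝ ↦ g (ofComplex (x + t * I))) (Set.Ioi 0) :=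
  (continuousOn_comp_ofComplex hol).comp (f := fun t : ℝ ↦ (x : ℂ) + t * I)
    (Continuous.continuousOn (by fun_prop)) fun t ht ↦ by simpa using ht

lemma continuous_horizontal {g : ℍ → ℂ} (hol : MDiff g) {t : ℝ} (ht : 0 < t) :
    Continuous fun x : ℝ ↦ g (ofComplex (x + t * I)) :=
  (continuousOn_comp_ofComplex hol).comp_continuous (f := fun x : ℝ ↦ (x : ℂ) + t * I)
    (by fun_prop) fun x ↦ by simpa using ht

lemma tendsto_im_atImInfty : Tendsto UpperHalfPlane.im atImInfty atTop := tendsto_comap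

/-- Twisted periodicity of a function on the upper half-plane: translation by `1` multiplies it by
the unimodular constant `e(κ)`. -/
def IsTwisted (κ : ℝ) (g : ℍ → ℂ) : Prop :=
  ∀ z : ℍ, g ((1 : ℝ) +ᵥ z) = fourierExp κ 1 * g z

/-- The function `e(-κ z) g z`, which is periodic when `g` is twisted with parameter `κ`; it reduces
twisted Fourier expansions to Mathlib's `qExpansion`. -/
def untwist (κ : ℝ) (g : ℍ → ℂ) (z : ℍ) : ℂ := fourierExp (-κ) z * g z

/-- The coefficient of the frequency `n + κ` in the Fourier expansion of a function twisted with
parameter `κ`. -/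
def twistedCoef (κ : ℝ) (g : ℍ → ℂ) (n : ℕ) : ℂ := (qExpansion 1 (untwist κ g)).coeff n

section Untwist

variable {κ : ℝ} {g : ℍ → ℂ}

lemma IsTwisted.sub_one (hg : IsTwisted κ g) : IsTwisted (κ - 1) g := fun z ↦ by
  have h := fourierExp_intCast_one (-1)
  rw [Int.cast_neg, Int.cast_one] at h
  rw [hg z, sub_eq_add_neg, fourierExp_freq_add, h, mul_one]

lemma norm_untwist (κ : ℝ) (g : ℍ → ℂ) (z : ℍ) :
    ‖untwist κ g z‖ = Real.exp (2 * π * κ * z.im) * ‖g z‖ := by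
  rw [untwist, norm_mul, norm_fourierExp, coe_im]
  ring_nf

lemma fourierExp_mul_untwist (κ : ℝ) (g : ℍ → ℂ) (z : ℍ) :
    fourierExp κ z * untwist κ g z = g z := by
  rw [untwist, ← mul_assoc, ← fourierExp_freq_add, add_neg_cancel, fourierExp_freq_zero, one_mul]

lemma norm_eq_exp_mul_norm_untwist (κ : ℝ) (g : ℍ → ℂ) (z : ℍ) :
    ‖g z‖ = Real.exp (-(2 * π * κ * z.im)) * ‖untwist κ g z‖ := by
  rw [← coe_im, ← norm_fourierExp, ← norm_mul, fourierExp_mul_untwist]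

lemma periodic_untwist (hg : IsTwisted κ g) :
    Function.Periodic (untwist κ g ∘ ofComplex) ((1 : ℝ) : ℂ) := by
  intro w
  by_cases hw : 0 < w.im
  · have hvadd : ofComplex (w + (1 : ℝ)) = (1 : ℝ) +ᵥ ofComplex w := by
      have := ofComplex_one_add_mul_I (x := w.re) hw
      rw [Complex.re_add_im, Complex.ofReal_add, add_assoc, Complex.re_add_im] at this
      rwa [add_comm]
    rw [Function.comp_apply, Function.comp_apply, hvadd, untwist, untwist, hg, coe_vadd,
      ← mul_assoc, fourierExp_add, mul_right_comm (fourierExp _ _), Complex.ofReal_one,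
      ← fourierExp_freq_add, neg_add_cancel, fourierExp_freq_zero, one_mul]
  · rw [Function.comp_apply, Function.comp_apply,
      ofComplex_apply_eq_of_im_nonpos (w' := w) (by simpa using hw) (by simpa using hw)]

lemma mdifferentiable_untwist (hol : MDiff g) : MDiff (untwist κ g) := by
  rw [UpperHalfPlane.mdifferentiable_iff] at hol ⊢
  refine ((differentiable_fourierExp (-κ)).differentiableOn.mul hol).congr fun z hz ↦ ?_
  simp only [Function.comp_apply, untwist, Pi.mul_apply, ofComplex_apply_of_im_pos hz]

lemma isZeroAtImInfty_untwist_of_neg (hκ : κ < 0) {K : ℝ}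
    (hb : g =O[atImInfty] fun z ↦ z.im ^ K) : IsZeroAtImInfty (untwist κ g) := by
  have hO : untwist κ g =O[atImInfty]
      fun z ↦ Real.exp (-(2 * π * -κ) * z.im) * z.im ^ K :=
    IsBigO.mul (IsBigO.of_norm_eventuallyLE (Eventually.of_forall fun z ↦
      (norm_fourierExp (-κ) z).le.trans_eq (by rw [coe_im]; ring_nf))) hb
  refine hO.trans_tendsto ?_
  have hlim := tendsto_rpow_mul_exp_neg_mul_atTop_nhds_zero K (2 * π * -κ)
    (mul_pos Real.two_pi_pos (neg_pos.2 hκ))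
  exact (hlim.comp tendsto_im_atImInfty).congr fun z ↦ mul_comm _ _

/-- Since `g` is also twisted with parameter `κ - 1 < 0`, the function `e((1 - κ) z) g z` is
periodic and tends to zero, hence is `O(e(z))`. -/
lemma isBoundedAtImInfty_untwist (hκ : κ < 1) (hg : IsTwisted κ g) (hol : MDiff g) {K : ℝ}
    (hb : g =O[atImInfty] fun z ↦ z.im ^ K) : IsBoundedAtImInfty (untwist κ g) := by
  have hzero := isZeroAtImInfty_untwist_of_neg (sub_neg.2 hκ) hb
  obtain ⟨C, hC⟩ := (hzero.exp_decay_atImInfty one_pos (periodic_untwist hg.sub_one)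
    (mdifferentiable_untwist hol) hzero.isBoundedAtImInfty).bound
  refine IsBigO.of_bound C ?_
  filter_upwards [hC] with z hz
  calc ‖untwist κ g z‖ = Real.exp (2 * π * z.im) * ‖untwist (κ - 1) g z‖ := by
        rw [norm_untwist, norm_untwist, ← mul_assoc, ← Real.exp_add]
        ring_nf
    _ ≤ Real.exp (2 * π * z.im) * (C * ‖Real.exp (-2 * π * z.im / 1)‖) := by gcongr
    _ = C * ‖(1 : ℍ → ℝ) z‖ := by
        rw [Real.norm_of_nonneg (Real.exp_pos _).le, mul_left_comm, ← Real.exp_add]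
        simp

lemma twistedCoef_eq_integral (hg : IsTwisted κ g) (hol : MDiff g)
    (hb : IsBoundedAtImInfty (untwist κ g)) (n : ℕ) {t : ℝ} (ht : 0 < t) :
    twistedCoef κ g n = ∫ u in (0 : ℝ)..1,
      g (ofComplex (u + t * I)) * fourierExp (-(n + κ)) (u + t * I) := by
  rw [twistedCoef, qExpansion_coeff_eq_intervalIntegral one_pos (periodic_untwist hg)
    (mdifferentiable_untwist hol) hb n ht]
  simp only [Complex.ofReal_one, div_one, one_mul]
  refine intervalIntegral.integral_congr fun u _ ↦ ?_
  have hq : 1 / Function.Periodic.qParam 1 (u + t * I) ^ n = fourierExp (-n) (u + t * I) := by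
    rw [Function.Periodic.qParam, one_div, ← Complex.exp_nat_mul, ← Complex.exp_neg, fourierExp]
    congr 1
    push_cast
    ring
  have him : 0 < ((u : ℂ) + t * I).im := by simpa using ht
  refine Eq.trans (congrArg (· * _) hq) ?_
  rw [ofComplex_apply_of_im_pos him, neg_add, fourierExp_freq_add]
  simp only [untwist, coe_I]
  ring

lemma hasSum_twistedCoef (hg : IsTwisted κ g) (hol : MDiff g)
    (hb : IsBoundedAtImInfty (untwist κ g)) (z : ℍ) :
    HasSum (fun n : ℕ ↦ twistedCoef κ g n * fourierExp (n + κ) z) (g z) := by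
  have h := (hasSum_qExpansion one_pos (periodic_untwist hg)
    (mdifferentiable_untwist hol) hb z).mul_left (fourierExp κ z)
  rw [fourierExp_mul_untwist] at h
  refine h.congr_fun fun n ↦ ?_
  have hq : Function.Periodic.qParam 1 z = fourierExp 1 z := by
    simp [Function.Periodic.qParam, fourierExp]
  rw [hq, ← fourierExp_natCast, fourierExp_freq_add, smul_eq_mul, ← twistedCoef]
  ring

lemma twistedCoef_zero (hg : IsTwisted κ g) (hol : MDiff g)
    (hb : IsBoundedAtImInfty (untwist κ g)) :
    twistedCoef κ g 0 = UpperHalfPlane.valueAtInfty (untwist κ g) := by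
  have hper := periodic_untwist hg
  rw [twistedCoef, qExpansion_coeff_zero one_pos
    (analyticAt_cuspFunction_zero one_pos hper (mdifferentiable_untwist hol) hb) hper]

lemma isBigO_exp_of_pos (hb : IsBoundedAtImInfty (untwist κ g)) :
    g =O[atImInfty] fun z ↦ Real.exp (-(2 * π * κ) * z.im) := by
  obtain ⟨C, hC⟩ := hb.bound
  refine IsBigO.of_bound C ?_
  filter_upwards [hC] with z hz
  rw [norm_eq_exp_mul_norm_untwist κ, Real.norm_of_nonneg (Real.exp_pos _).le, neg_mul,
    mul_comm C]
  gcongr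
  simpa using hz

lemma isBigO_exp_of_twistedCoef_zero (hκ : 0 ≤ κ) (hg : IsTwisted κ g) (hol : MDiff g)
    (hb : IsBoundedAtImInfty (untwist κ g)) (h0 : twistedCoef κ g 0 = 0) :
    g =O[atImInfty] fun z ↦ Real.exp (-(2 * π) * z.im) := by
  have hdecay := exp_decay_sub_atImInfty one_pos (periodic_untwist hg)
    (mdifferentiable_untwist hol) hb
  rw [← twistedCoef_zero hg hol hb, h0] at hdecay
  simp only [sub_zero, div_one, ← neg_mul] at hdecay ⊢
  refine (isBigO_of_le _ fun z ↦ ?_ : g =O[atImInfty] untwist κ g).trans hdecay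
  rw [← fourierExp_mul_untwist κ g, norm_mul]
  exact mul_le_of_le_one_left (norm_nonneg _) (norm_fourierExp_le_one hκ z.im_pos.le)

lemma isBigO_rpow_of_cuspidal (hκ : 0 ≤ κ) (hg : IsTwisted κ g) (hol : MDiff g)
    (hb : IsBoundedAtImInfty (untwist κ g)) (hc : 0 < κ ∨ twistedCoef κ g 0 = 0) (s : ℝ) :
    g =O[atImInfty] fun z ↦ z.im ^ s := by
  obtain ⟨δ, hδ, hO⟩ : ∃ δ > 0, g =O[atImInfty] fun z ↦ Real.exp (-δ * z.im) := by
    rcases hc with hκ' | h0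
    · exact ⟨2 * π * κ, by positivity, isBigO_exp_of_pos hb⟩
    · exact ⟨2 * π, by positivity, isBigO_exp_of_twistedCoef_zero hκ hg hol hb h0⟩
  exact hO.trans ((isLittleO_exp_neg_mul_rpow_atTop hδ s).isBigO.comp_tendsto tendsto_im_atImInfty)

end Untwist

/-- A holomorphic function on the upper half-plane with twisted periodicity and the growth of a cusp
form: `‖g z‖ ≤ C (im z) ^ (-β)` for some `β > 0`. For a form of weight `r` one has `β = r / 2`. -/
structure IsTwistedForm (κ β C : ℝ) (g : ℍ → ℂ) : Prop where
  twist : IsTwisted κ g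
  holo : MDiff g
  param_nonneg : 0 ≤ κ
  param_lt_one : κ < 1
  exponent_pos : 0 < β
  bound : ∀ z : ℍ, ‖g z‖ ≤ C * z.im ^ (-β)

/-- The sum of the first `N` terms of the twisted Fourier expansion of `g` at `z`. -/
def twistedPartialSum (κ : ℝ) (g : ℍ → ℂ) (N : ℕ) (z : ℂ) : ℂ :=
  ∑ n ∈ Finset.range N, twistedCoef κ g n * fourierExp (n + κ) z

namespace IsTwistedForm

variable {κ β C : ℝ} {g : ℍ → ℂ}

lemma const_nonneg (h : IsTwistedForm κ β C g) : 0 ≤ C := by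
  have := h.bound UpperHalfPlane.I
  rw [I_im, Real.one_rpow, mul_one] at this
  exact (norm_nonneg _).trans this

lemma const_mul (h : IsTwistedForm κ β C g) (b : ℂ) :
    IsTwistedForm κ β (‖b‖ * C) fun z ↦ b * g z where
  twist z := by simp only [h.twist z, mul_left_comm]
  holo := mdifferentiable_const.mul h.holo
  param_nonneg := h.param_nonneg
  param_lt_one := h.param_lt_one
  exponent_pos := h.exponent_pos
  bound z := by
    rw [norm_mul, mul_assoc]
    gcongr
    exact h.bound z

lemma isBoundedAtImInfty_untwist (h : IsTwistedForm κ β C g) :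
    IsBoundedAtImInfty (untwist κ g) := by
  refine FracModular.isBoundedAtImInfty_untwist h.param_lt_one h.twist h.holo (K := -β)
    (IsBigO.of_bound C (Eventually.of_forall fun z ↦ ?_))
  rw [Real.norm_of_nonneg (Real.rpow_nonneg z.im_pos.le _)]
  exact h.bound z

lemma coef_eq_integral (h : IsTwistedForm κ β C g) (n : ℕ) {t : ℝ} (ht : 0 < t) :
    twistedCoef κ g n = ∫ u in (0 : ℝ)..1,
      g (ofComplex (u + t * I)) * fourierExp (-(n + κ)) (u + t * I) :=
  twistedCoef_eq_integral h.twist h.holo h.isBoundedAtImInfty_untwist n ht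

lemma hasSum (h : IsTwistedForm κ β C g) (z : ℍ) :
    HasSum (fun n : ℕ ↦ twistedCoef κ g n * fourierExp (n + κ) z) (g z) :=
  hasSum_twistedCoef h.twist h.holo h.isBoundedAtImInfty_untwist z

lemma tendsto_twistedPartialSum (h : IsTwistedForm κ β C g) (z : ℍ) :
    Tendsto (fun N ↦ twistedPartialSum κ g N z) atTop (𝓝 (g z)) :=
  (h.hasSum z).tendsto_sum_nat

lemma coef_zero (h : IsTwistedForm κ β C g) (hκ : κ = 0) : twistedCoef κ g 0 = 0 := by
  subst hκ
  rw [twistedCoef_zero h.twist h.holo h.isBoundedAtImInfty_untwist]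
  apply IsZeroAtImInfty.valueAtInfty_eq_zero
  refine squeeze_zero_norm (a := fun z : ℍ ↦ C * z.im ^ (-β)) (fun z ↦ ?_) ?_
  · simpa [norm_untwist] using h.bound z
  · simpa using ((tendsto_rpow_neg_atTop h.exponent_pos).comp tendsto_im_atImInfty).const_mul C

lemma exists_freq_bound (h : IsTwistedForm κ β C g) :
    ∃ δ > 0, ∀ n : ℕ, twistedCoef κ g n = 0 ∨ δ ≤ n + κ := by
  rcases h.param_nonneg.lt_or_eq with hκ | hκ
  · exact ⟨κ, hκ, fun n ↦ Or.inr (le_add_of_nonneg_left n.cast_nonneg)⟩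
  · refine ⟨1, one_pos, fun n ↦ ?_⟩
    rcases Nat.eq_zero_or_pos n with rfl | hn
    · exact Or.inl (h.coef_zero hκ.symm)
    · rw [← hκ, add_zero]
      exact Or.inr (by exact_mod_cast hn)

end IsTwistedForm

/-! ### Partial sums of twisted Fourier series -/

lemma two_div_pi_mul_norm_le_norm_sin {z : ℂ} (hz : |z.re| ≤ π / 2) :
    2 / π * ‖z‖ ≤ ‖Complex.sin z‖ := by
  have hnorm : ‖Complex.sin z‖ ^ 2 = Real.sin z.re ^ 2 + Real.sinh z.im ^ 2 := by
    rw [Complex.sin_eq, ← Complex.ofReal_sin, ← Complex.ofReal_cos, ← Complex.ofReal_sinh,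
      ← Complex.ofReal_cosh, ← Complex.ofReal_mul, ← Complex.ofReal_mul,
      ← Complex.normSq_eq_norm_sq, Complex.normSq_add_mul_I]
    linear_combination Real.sin z.re ^ 2 * Real.cosh_sq z.im +
      Real.sinh z.im ^ 2 * Real.sin_sq_add_cos_sq z.re
  have hre : 2 / π * |z.re| ≤ |Real.sin z.re| := Real.mul_abs_le_abs_sin hz
  have him : 2 / π * |z.im| ≤ |Real.sinh z.im| := by
    rw [Real.abs_sinh]
    refine (mul_le_of_le_one_left (abs_nonneg _) ?_).trans
      (Real.self_le_sinh_iff.2 (abs_nonneg _))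
    exact (div_le_one Real.pi_pos).2 Real.two_le_pi
  refine le_of_sq_le_sq ?_ (norm_nonneg _)
  rw [hnorm, mul_pow, ← Complex.normSq_eq_norm_sq, Complex.normSq_apply, ← sq, ← sq, mul_add,
    ← sq_abs z.re, ← sq_abs z.im, ← mul_pow, ← mul_pow, ← sq_abs (Real.sin _),
    ← sq_abs (Real.sinh _)]
  gcongr

lemma exp_mul_norm_le_norm_one_sub_fourierExp {w : ℂ} (hw : |w.re| ≤ 1 / 2) :
    4 * Real.exp (-(π * w.im)) * ‖w‖ ≤ ‖1 - fourierExp 1 w‖ := by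
  have hsin : 1 - fourierExp 1 w = -2 * I * Complex.exp (π * w * I) * Complex.sin (π * w) := by
    have hsq : fourierExp 1 w = Complex.exp (π * w * I) * Complex.exp (π * w * I) := by
      rw [fourierExp, ← Complex.exp_add]
      congr 1
      push_cast
      ring
    have hinv : Complex.exp (-(π * w) * I) * Complex.exp (π * w * I) = 1 := by
      rw [← Complex.exp_add, neg_mul, neg_add_cancel, Complex.exp_zero]
    rw [hsq, Complex.sin]
    linear_combination (Complex.exp (π * w * I) * Complex.exp (-(π * w) * I) -
      Complex.exp (π * w * I) ^ 2) * Complex.I_sq - hinv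
  have hjordan : 2 * ‖w‖ ≤ ‖Complex.sin (π * w)‖ := by
    have h := two_div_pi_mul_norm_le_norm_sin (z := π * w) (by
      rw [Complex.re_ofReal_mul, abs_mul, abs_of_pos Real.pi_pos, div_eq_mul_one_div]
      gcongr)
    rwa [norm_mul, Complex.norm_real, Real.norm_of_nonneg Real.pi_pos.le, ← mul_assoc,
      div_mul_cancel₀ _ Real.pi_ne_zero] at h
  calc 4 * Real.exp (-(π * w.im)) * ‖w‖ = 2 * Real.exp (-(π * w.im)) * (2 * ‖w‖) := by ring
    _ ≤ 2 * Real.exp (-(π * w.im)) * ‖Complex.sin (π * w)‖ := by gcongr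
    _ = ‖1 - fourierExp 1 w‖ := by
      rw [hsin]
      simp [Complex.norm_exp]

lemma norm_geom_sum_le {q : ℂ} (hq : ‖q‖ ≤ 1) (hq1 : q ≠ 1) (N : ℕ) :
    ‖∑ n ∈ Finset.range N, q ^ n‖ ≤ 2 / ‖1 - q‖ := by
  rw [geom_sum_eq hq1, norm_div, norm_sub_rev q 1]
  gcongr
  calc ‖q ^ N - 1‖ ≤ ‖q ^ N‖ + ‖(1 : ℂ)‖ := norm_sub_le _ _
    _ ≤ 1 + 1 := by
      rw [norm_pow, norm_one]
      gcongr
      exact pow_le_one₀ (norm_nonneg _) hq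
    _ = 2 := one_add_one_eq_two

lemma norm_sum_fourierExp_le {κ : ℝ} (hκ : 0 ≤ κ) {w : ℂ} (hre : |w.re| ≤ 1 / 2)
    (him : 0 < w.im) (N : ℕ) :
    ‖∑ n ∈ Finset.range N, fourierExp (n + κ) w‖ ≤ Real.exp (π * w.im) / (2 * ‖w‖) := by
  have hw : 0 < ‖w‖ := norm_pos_iff.2 fun h ↦ by simp [h] at him
  have hlow := exp_mul_norm_le_norm_one_sub_fourierExp hre
  have hpos : 0 < ‖1 - fourierExp 1 w‖ := hlow.trans_lt' (by positivity)
  have hsum : ∑ n ∈ Finset.range N, fourierExp (n + κ) w =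
      (∑ n ∈ Finset.range N, fourierExp 1 w ^ n) * fourierExp κ w := by
    simp only [fourierExp_freq_add, fourierExp_natCast, Finset.sum_mul]
  calc ‖∑ n ∈ Finset.range N, fourierExp (n + κ) w‖ ≤ 2 / ‖1 - fourierExp 1 w‖ := by
        rw [hsum, norm_mul]
        exact (mul_le_of_le_one_right (norm_nonneg _) (norm_fourierExp_le_one hκ him.le)).trans
          (norm_geom_sum_le (norm_fourierExp_le_one zero_le_one him.le)
            (sub_ne_zero.1 (norm_pos_iff.1 hpos)).symm N)
    _ ≤ 2 / (4 * Real.exp (-(π * w.im)) * ‖w‖) := by gcongr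
    _ = Real.exp (π * w.im) / (2 * ‖w‖) := by
      rw [Real.exp_neg]
      field_simp
      norm_num

lemma abs_im_rpow_mul_abs_re_rpow_le_norm {ε : ℝ} (hε : 0 ≤ ε) (hε' : ε ≤ 1) (w : ℂ) :
    |w.im| ^ ε * |w.re| ^ (1 - ε) ≤ ‖w‖ := by
  have h1ε : 0 ≤ 1 - ε := sub_nonneg.2 hε'
  calc |w.im| ^ ε * |w.re| ^ (1 - ε) ≤ ‖w‖ ^ ε * ‖w‖ ^ (1 - ε) := by
        gcongr
        · exact Complex.abs_im_le_norm w
        · exact Complex.abs_re_le_norm w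
    _ = ‖w‖ := by
      rw [← Real.rpow_add_of_nonneg (norm_nonneg _) hε h1ε, add_sub_cancel, Real.rpow_one]

lemma norm_sum_fourierExp_le_rpow {κ ε t v : ℝ} (hκ : 0 ≤ κ) (hε : 0 ≤ ε) (hε1 : ε ≤ 1)
    (ht : 0 < t) (ht1 : t ≤ 1) (hv0 : v ≠ 0) (hv : |v| ≤ 1 / 2) (N : ℕ) :
    ‖∑ n ∈ Finset.range N, fourierExp (n + κ) (-v + t * I)‖ ≤
      Real.exp π * t ^ (-ε) * |v| ^ (ε - 1) := by
  set w : ℂ := -v + t * I with hw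
  have hre : |w.re| = |v| := by simp [hw]
  have him : w.im = t := by simp [hw]
  have hv' : 0 < |v| := abs_pos.2 hv0
  have hnorm := abs_im_rpow_mul_abs_re_rpow_le_norm hε hε1 w
  rw [him, hre, abs_of_pos ht] at hnorm
  calc _ ≤ Real.exp (π * w.im) / (2 * ‖w‖) :=
        norm_sum_fourierExp_le hκ (hre.trans_le hv) (him ▸ ht) N
    _ ≤ Real.exp π / (1 * (t ^ ε * |v| ^ (1 - ε))) := by
        gcongr
        · rw [him]
          nlinarith [Real.pi_pos]
        · norm_num
    _ = _ := by
        rw [Real.rpow_neg ht.le, ← neg_sub 1 ε, Real.rpow_neg hv'.le]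
        field_simp

lemma intervalIntegrable_abs_rpow {s : ℝ} (hs : -1 < s) (a b : ℝ) :
    IntervalIntegrable (fun v : ℝ ↦ |v| ^ s) volume a b := by
  have h := (intervalIntegral.intervalIntegrable_cpow' (a := a) (b := b) (r := (s : ℂ))
    (by simpa using hs)).norm
  refine h.congr_ae (ae_restrict_of_ae ?_)
  filter_upwards [compl_mem_ae_iff.2 (measure_singleton 0)] with v hv
  rw [Complex.norm_cpow_of_ne_zero (by exact_mod_cast hv)]
  simp

namespace IsTwistedForm

variable {κ β C : ℝ} {g : ℍ → ℂ}

lemma coef_mul_fourierExp_eq_integral (h : IsTwistedForm κ β C g) (n : ℕ) (x t : ℝ) {s : ℝ}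
    (hs : 0 < s) :
    twistedCoef κ g n * fourierExp (n + κ) (x + (s + t) * I) =
      ∫ v in (-(1 / 2) : ℝ)..(1 / 2),
        g (ofComplex ((x + v : ℝ) + s * I)) * fourierExp (n + κ) (-v + t * I) := by
  set P : ℝ → ℂ := fun u ↦ g (ofComplex (u + s * I)) * fourierExp (n + κ) (x - u + t * I) with hP
  have hper : Function.Periodic P 1 := fun u ↦ by
    have hshift : fourierExp (n + κ) (x - u + t * I) =
        fourierExp κ 1 * fourierExp (n + κ) (x - (u + 1 : ℝ) + t * I) := by
      rw [show (x - u + t * I : ℂ) = 1 + (x - (u + 1 : ℝ) + t * I) by push_cast; ring,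
        fourierExp_add, fourierExp_freq_add, fourierExp_natCast, ← Int.cast_one,
        fourierExp_intCast_one]
      simp
    simp only [hP]
    rw [add_comm u 1, ofComplex_one_add_mul_I hs, h.twist, hshift, add_comm u 1]
    ring
  calc twistedCoef κ g n * fourierExp (n + κ) (x + (s + t) * I)
      = ∫ u in (0 : ℝ)..(0 + 1), P u := by
        rw [h.coef_eq_integral n hs, ← intervalIntegral.integral_mul_const, zero_add]
        refine intervalIntegral.integral_congr fun u _ ↦ ?_
        simp only [hP]
        rw [show (x - u + t * I : ℂ) = (x + (s + t) * I) - (u + s * I) by ring, mul_assoc]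
        simp only [fourierExp, ← Complex.exp_add]
        push_cast
        ring_nf
    _ = ∫ v in (-(1 / 2) : ℝ)..(1 / 2), P (x + v) := by
        rw [hper.intervalIntegral_add_eq 0 (x + -(1 / 2)), intervalIntegral.integral_comp_add_left]
        ring_nf
    _ = _ := by
        simp only [hP, Complex.ofReal_add, sub_add_cancel_left]

lemma twistedPartialSum_eq_integral (h : IsTwistedForm κ β C g) (N : ℕ) (x t : ℝ) {s : ℝ}
    (hs : 0 < s) :
    twistedPartialSum κ g N (x + (s + t) * I) =
      ∫ v in (-(1 / 2) : ℝ)..(1 / 2), g (ofComplex ((x + v : ℝ) + s * I)) *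
        ∑ n ∈ Finset.range N, fourierExp (n + κ) (-v + t * I) := by
  have hcont : Continuous fun v : ℝ ↦ g (ofComplex ((x + v : ℝ) + s * I)) :=
    (continuous_horizontal h.holo hs).comp (continuous_const.add continuous_id)
  simp_rw [Finset.mul_sum]
  rw [intervalIntegral.integral_finsetSum]
  · exact Finset.sum_congr rfl fun n _ ↦ h.coef_mul_fourierExp_eq_integral n x t hs
  · intro n _
    exact (hcont.mul (by fun_prop)).intervalIntegrable _ _

/-- The partial sums are convolutions with a Dirichlet-type kernel of size `1 / ‖w‖`, which costs
an arbitrarily small power of the height only. -/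
lemma exists_norm_twistedPartialSum_le_rpow (h : IsTwistedForm κ β C g) {ε : ℝ} (hε : 0 < ε)
    (hε1 : ε < 1) :
    ∃ D, 0 ≤ D ∧ ∀ (N : ℕ) (x t : ℝ), 0 < t → t ≤ 1 →
      ‖twistedPartialSum κ g N (x + t * I)‖ ≤ D * t ^ (-(β + ε)) := by
  have hC := h.const_nonneg
  set M := ∫ v in (-(1 / 2) : ℝ)..(1 / 2), |v| ^ (ε - 1) with hM
  have hM0 : 0 ≤ M := intervalIntegral.integral_nonneg (by norm_num) fun v _ ↦ by positivity
  refine ⟨C * Real.exp π * 2 ^ (β + ε) * M, by positivity, fun N x t ht ht1 ↦ ?_⟩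
  have ht2 : 0 < t / 2 := by positivity
  have hbound : ∀ᵐ v : ℝ, v ∈ Set.Ioc (-(1 / 2) : ℝ) (1 / 2) →
      ‖g (ofComplex ((x + v : ℝ) + (t / 2 : ℝ) * I)) *
        ∑ n ∈ Finset.range N, fourierExp (n + κ) (-v + (t / 2 : ℝ) * I)‖ ≤
      C * Real.exp π * (t / 2) ^ (-(β + ε)) * |v| ^ (ε - 1) := by
    filter_upwards [compl_mem_ae_iff.2 (measure_singleton 0)] with v hv0 hv
    have hg := h.bound (ofComplex ((x + v : ℝ) + (t / 2 : ℝ) * I))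
    rw [im_ofComplex_add_mul_I ht2] at hg
    calc _ ≤ C * (t / 2) ^ (-β) * (Real.exp π * (t / 2) ^ (-ε) * |v| ^ (ε - 1)) := by
          rw [norm_mul]
          gcongr
          exact norm_sum_fourierExp_le_rpow h.param_nonneg hε.le hε1.le ht2 (by linarith) hv0
            (abs_le.2 ⟨hv.1.le, hv.2⟩) N
      _ = _ := by
          rw [neg_add, Real.rpow_add ht2]
          ring
  have hsplit : (x + t * I : ℂ) = x + ((t / 2 : ℝ) + (t / 2 : ℝ)) * I := by
    push_cast
    ring
  rw [hsplit, h.twistedPartialSum_eq_integral N x _ ht2]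
  refine (intervalIntegral.norm_integral_le_of_norm_le (by norm_num) hbound
    ((intervalIntegrable_abs_rpow (by linarith) _ _).const_mul _)).trans_eq ?_
  rw [intervalIntegral.integral_const_mul, ← hM, Real.div_rpow ht.le zero_le_two,
    Real.rpow_neg zero_le_two, div_inv_eq_mul]
  ring

lemma exists_norm_twistedPartialSum_le_exp (h : IsTwistedForm κ β C g) :
    ∃ E δ, 0 ≤ E ∧ 0 < δ ∧ ∀ (N : ℕ) (z : ℂ), 1 ≤ z.im →
      ‖twistedPartialSum κ g N z‖ ≤ E * Real.exp (-δ * z.im) := by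
  obtain ⟨δ, hδ, hfreq⟩ := h.exists_freq_bound
  have hsum := (h.hasSum UpperHalfPlane.I).summable.norm
  refine ⟨(∑' n : ℕ, ‖twistedCoef κ g n * fourierExp (n + κ) UpperHalfPlane.I‖) *
    Real.exp (2 * π * δ), 2 * π * δ, by positivity, by positivity, fun N z hz ↦ ?_⟩
  have hterm : ∀ n : ℕ, ‖twistedCoef κ g n * fourierExp (n + κ) z‖ ≤
      ‖twistedCoef κ g n * fourierExp (n + κ) UpperHalfPlane.I‖ *
        (Real.exp (2 * π * δ) * Real.exp (-(2 * π * δ) * z.im)) := fun n ↦ by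
    rcases hfreq n with h0 | h1
    · simp [h0]
    · rw [norm_mul, norm_mul, norm_fourierExp, norm_fourierExp, coe_I, Complex.I_im,
        mul_assoc ‖_‖, ← Real.exp_add, ← Real.exp_add]
      gcongr
      nlinarith [mul_nonneg (mul_nonneg Real.pi_pos.le (sub_nonneg.2 h1)) (sub_nonneg.2 hz)]
  calc ‖twistedPartialSum κ g N z‖
      ≤ ∑ n ∈ Finset.range N, ‖twistedCoef κ g n * fourierExp (n + κ) UpperHalfPlane.I‖ *
        (Real.exp (2 * π * δ) * Real.exp (-(2 * π * δ) * z.im)) :=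
        (norm_sum_le _ _).trans (Finset.sum_le_sum fun n _ ↦ hterm n)
    _ ≤ _ := by
        rw [← Finset.sum_mul, ← mul_assoc]
        gcongr
        exact hsum.sum_le_tsum _ fun n _ ↦ norm_nonneg _

lemma exists_norm_twistedPartialSum_le (h : IsTwistedForm κ β C g) {ε : ℝ} (hε : 0 < ε)
    (hε1 : ε < 1) :
    ∃ D E δ, 0 < δ ∧ ∀ (N : ℕ) (x t : ℝ), 0 < t →
      ‖twistedPartialSum κ g N (x + t * I)‖ ≤
        (D * t ^ (-(β + ε)) + E) * Real.exp (-δ * t) := by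
  obtain ⟨D, hD0, hD⟩ := h.exists_norm_twistedPartialSum_le_rpow hε hε1
  obtain ⟨E, δ, hE0, hδ, hE⟩ := h.exists_norm_twistedPartialSum_le_exp
  refine ⟨D * Real.exp δ, E, δ, hδ, fun N x t ht ↦ ?_⟩
  rcases le_total t 1 with ht1 | ht1
  · calc _ ≤ D * t ^ (-(β + ε)) * 1 := (hD N x t ht ht1).trans_eq (mul_one _).symm
      _ ≤ D * t ^ (-(β + ε)) * Real.exp (δ + -δ * t) := by
          gcongr
          rw [Real.one_le_exp_iff]
          nlinarith
      _ = D * Real.exp δ * t ^ (-(β + ε)) * Real.exp (-δ * t) := by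
          rw [Real.exp_add]
          ring
      _ ≤ _ := by
          gcongr
          exact le_add_of_nonneg_right hE0
  · have him : (x + t * I : ℂ).im = t := by simp
    refine (hE N _ (him.symm ▸ ht1)).trans ?_
    rw [him]
    gcongr
    exact le_add_of_nonneg_left (by positivity)

end IsTwistedForm

/-- The Mellin transform `∫₀^∞ t ^ (α - 1) g (x + i t) dt` of `g` along a vertical line, of which
the `α`-fractional integral of `g` is a multiple. -/
def verticalMellin (α : ℝ) (g : ℍ → ℂ) (x : ℝ) : ℂ :=
  mellin (fun t ↦ g (ofComplex (x + t * I))) α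

lemma integrableOn_rpow_mul_exp {s δ : ℝ} (hs : -1 < s) (hδ : 0 < δ) :
    IntegrableOn (fun t : ℝ ↦ t ^ s * Real.exp (-δ * t)) (Set.Ioi 0) := by
  simpa only [Real.rpow_one] using integrableOn_rpow_mul_exp_neg_mul_rpow hs one_pos hδ

lemma fourierExp_add_mul_I (a x t : ℝ) :
    fourierExp a (x + t * I) = fourierExp a x * (Real.exp (-(2 * π * a) * t) : ℝ) := by
  rw [fourierExp_add, Complex.ofReal_exp, fourierExp, fourierExp]
  congr 2
  push_cast
  linear_combination (2 * π * a * t : ℂ) * Complex.I_sq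

lemma continuousOn_cpow_smul {φ : ℝ → ℂ} (hφ : ContinuousOn φ (Set.Ioi 0)) (s : ℂ) :
    ContinuousOn (fun t : ℝ ↦ (t : ℂ) ^ s • φ t) (Set.Ioi 0) :=
  .smul (fun t ht ↦ (Complex.continuousAt_ofReal_cpow_const t s
    (Or.inr (ne_of_gt ht))).continuousWithinAt) hφ

namespace IsTwistedForm

variable {κ β C : ℝ} {g : ℍ → ℂ}

lemma exists_integrable_majorant (h : IsTwistedForm κ β C g) {α : ℝ} (hα : β < α) :
    ∃ maj : ℝ → ℝ, IntegrableOn maj (Set.Ioi 0) ∧ ∀ (N : ℕ) (x t : ℝ), 0 < t →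
      ‖(t : ℂ) ^ (α - 1 : ℂ) • twistedPartialSum κ g N (x + t * I)‖ ≤ maj t := by
  obtain ⟨ε, hε, hε'⟩ := exists_between (lt_min one_pos (sub_pos.2 hα))
  obtain ⟨hε1, hεα⟩ := lt_min_iff.1 hε'
  have hβ := h.exponent_pos
  obtain ⟨D, E, δ, hδ, hbound⟩ := h.exists_norm_twistedPartialSum_le hε hε1
  refine ⟨fun t ↦ D * (t ^ (α - 1 - (β + ε)) * Real.exp (-δ * t)) +
      E * (t ^ (α - 1) * Real.exp (-δ * t)),
    ((integrableOn_rpow_mul_exp (by linarith) hδ).const_mul D).add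
      ((integrableOn_rpow_mul_exp (by linarith) hδ).const_mul E), fun N x t ht ↦ ?_⟩
  calc _ ≤ t ^ (α - 1) * ((D * t ^ (-(β + ε)) + E) * Real.exp (-δ * t)) := by
        rw [norm_smul, Complex.norm_cpow_eq_rpow_re_of_pos ht]
        simp only [Complex.sub_re, Complex.ofReal_re, Complex.one_re]
        gcongr
        exact hbound N x t ht
    _ = _ := by
        simp only [sub_eq_add_neg _ (β + ε), Real.rpow_add ht (α - 1)]
        ring

lemma tendsto_cpow_smul_twistedPartialSum (h : IsTwistedForm κ β C g) (s : ℂ) (x : ℝ) {t : ℝ}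
    (ht : 0 < t) :
    Tendsto (fun N ↦ (t : ℂ) ^ s • twistedPartialSum κ g N (x + t * I)) atTop
      (𝓝 ((t : ℂ) ^ s • g (ofComplex (x + t * I)))) := by
  have := h.tendsto_twistedPartialSum (ofComplex (x + t * I))
  rw [coe_ofComplex_add_mul_I ht] at this
  exact this.const_smul _

lemma mellinConvergent (h : IsTwistedForm κ β C g) {α : ℝ} (hα : β < α) (x : ℝ) :
    MellinConvergent (fun t ↦ g (ofComplex (x + t * I))) α := by
  obtain ⟨maj, hmaj, hle⟩ := h.exists_integrable_majorant hα
  refine Integrable.mono' hmaj ((continuousOn_cpow_smul (continuousOn_vertical h.holo x)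
    _).aestronglyMeasurable measurableSet_Ioi) ?_
  exact ae_restrict_of_forall_mem measurableSet_Ioi fun t ht ↦
    le_of_tendsto (h.tendsto_cpow_smul_twistedPartialSum _ x ht).norm
      (Eventually.of_forall fun N ↦ hle N x t ht)

lemma tendsto_mellin_twistedPartialSum (h : IsTwistedForm κ β C g) {α : ℝ} (hα : β < α)
    (x : ℝ) :
    Tendsto (fun N ↦ mellin (fun t ↦ twistedPartialSum κ g N (x + t * I)) α) atTop
      (𝓝 (verticalMellin α g x)) := by
  obtain ⟨maj, hmaj, hle⟩ := h.exists_integrable_majorant hα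
  refine tendsto_integral_of_dominated_convergence maj (fun N ↦ ?_) hmaj (fun N ↦ ?_) ?_
  · exact (continuousOn_cpow_smul (by unfold twistedPartialSum; fun_prop)
      _).aestronglyMeasurable measurableSet_Ioi
  · exact ae_restrict_of_forall_mem measurableSet_Ioi fun t ht ↦ hle N x t ht
  · exact ae_restrict_of_forall_mem measurableSet_Ioi fun t ht ↦
      h.tendsto_cpow_smul_twistedPartialSum _ x ht

lemma coef_eq_zero_or_pos (h : IsTwistedForm κ β C g) (n : ℕ) :
    twistedCoef κ g n = 0 ∨ 0 < (n : ℝ) + κ := by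
  by_cases hn : 0 < (n : ℝ) + κ
  · exact Or.inr hn
  · have hn0 : (n : ℝ) = 0 := le_antisymm (by linarith [h.param_nonneg]) n.cast_nonneg
    rw [Nat.cast_eq_zero.1 hn0]
    exact Or.inl (h.coef_zero (le_antisymm (by linarith) h.param_nonneg))

lemma mellin_twistedPartialSum (h : IsTwistedForm κ β C g) {α : ℝ} (hα : 0 < α) (N : ℕ)
    (x : ℝ) :
    mellin (fun t ↦ twistedPartialSum κ g N (x + t * I)) α =
      ((Real.Gamma α / (2 * π) ^ α : ℝ) : ℂ) * ∑ n ∈ Finset.range N, if 0 < (n : ℝ) + κ then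
        twistedCoef κ g n / ((((n : ℝ) + κ) ^ α : ℝ) : ℂ) * fourierExp (n + κ) x else 0 := by
  have hsum := hasSum_mellin (ι := Fin N) (s := α)
    (a := fun n ↦ twistedCoef κ g n * fourierExp (n + κ) x) (p := fun n ↦ 2 * π * (n + κ))
    (F := fun t ↦ twistedPartialSum κ g N (x + t * I))
    (fun n ↦ (h.coef_eq_zero_or_pos n).imp (fun hn ↦ by rw [hn, zero_mul]) fun hn ↦ by positivity)
    (by simpa using hα)
    (fun t _ ↦ by
      simp only [twistedPartialSum, ← Fin.sum_univ_eq_sum_range, fourierExp_add_mul_I, mul_assoc]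
      exact hasSum_fintype _)
    (hasSum_fintype _).summable
  rw [← hsum.tsum_eq, tsum_fintype, Finset.mul_sum, Fin.sum_univ_eq_sum_range fun n ↦
    Complex.Gamma α * (twistedCoef κ g n * fourierExp (n + κ) x) / (2 * π * (n + κ) : ℝ) ^ (α : ℂ)]
  refine Finset.sum_congr rfl fun n _ ↦ ?_
  split_ifs with hn
  · rw [Complex.Gamma_ofReal, ← Complex.ofReal_cpow (by positivity),
      Real.mul_rpow (by positivity) hn.le]
    push_cast
    ring
  · rw [(h.coef_eq_zero_or_pos n).resolve_right hn]
    simp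

lemma tendsto_fracSum (h : IsTwistedForm κ β C g) {α : ℝ} (hα : β < α) (x : ℝ) :
    Tendsto (fun N : ℕ ↦ ∑ n ∈ Finset.range N, if 0 < (n : ℝ) + κ then
        twistedCoef κ g n / ((((n : ℝ) + κ) ^ α : ℝ) : ℂ) * fourierExp (n + κ) x else 0) atTop
      (𝓝 (((2 * π) ^ α / Real.Gamma α : ℝ) * verticalMellin α g x)) := by
  have hα0 : 0 < α := h.exponent_pos.trans hα
  have hG : Real.Gamma α ≠ 0 := (Real.Gamma_pos_of_pos hα0).ne'
  have hπ : (2 * π) ^ α ≠ 0 := by positivity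
  refine ((h.tendsto_mellin_twistedPartialSum hα x).const_mul _).congr fun N ↦ ?_
  rw [h.mellin_twistedPartialSum hα0, ← mul_assoc, ← Complex.ofReal_mul,
    div_mul_div_cancel₀ hG, div_self hπ, Complex.ofReal_one, one_mul]

end IsTwistedForm

/-! ### Slash operators up to a unimodular constant -/

/-- `F` and `G` differ by a constant factor of absolute value one. This is the sense in which the
slash operators of real weight form an action: the branches of the powers only contribute such a
factor. -/
def EqUpToPhase (F G : ℍ → ℂ) : Prop := ∃ ω : ℂ, ‖ω‖ = 1 ∧ ∀ z, F z = ω * G z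

namespace EqUpToPhase

variable {F G H : ℍ → ℂ}

lemma symm (h : EqUpToPhase F G) : EqUpToPhase G F := by
  obtain ⟨ω, hω, hFG⟩ := h
  have hω₀ : ω ≠ 0 := norm_ne_zero_iff.1 (by simp [hω])
  exact ⟨ω⁻¹, by simp [hω], fun z ↦ by rw [hFG, inv_mul_cancel_left₀ hω₀]⟩

lemma trans (h₁ : EqUpToPhase F G) (h₂ : EqUpToPhase G H) : EqUpToPhase F H := by
  obtain ⟨ω₁, hω₁, hFG⟩ := h₁
  obtain ⟨ω₂, hω₂, hGH⟩ := h₂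
  exact ⟨ω₁ * ω₂, by simp [hω₁, hω₂], fun z ↦ by rw [hFG, hGH, mul_assoc]⟩

lemma norm_eq (h : EqUpToPhase F G) (z : ℍ) : ‖F z‖ = ‖G z‖ := by
  obtain ⟨ω, hω, hFG⟩ := h
  rw [hFG, norm_mul, hω, one_mul]

lemma slash (h : EqUpToPhase F G) (r : ℝ) (g : SL(2, ℝ)) :
    EqUpToPhase (slash r g F) (slash r g G) := by
  obtain ⟨ω, hω, hFG⟩ := h
  exact ⟨ω, hω, fun z ↦ by rw [FracModular.slash, FracModular.slash, hFG, mul_div_assoc]⟩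

end EqUpToPhase

section AutFactor

lemma coe_smul_eq_div_autFactor (g : SL(2, ℝ)) (z : ℍ) :
    ((g • z : ℍ) : ℂ) = (g 0 0 * z + g 0 1) / autFactor g z :=
  coe_specialLinearGroup_apply g z

lemma autFactor_eq_denom (g : SL(2, ℝ)) (z : ℍ) :
    autFactor g z = denom (SpecialLinearGroup.mapGL ℝ g) z := rfl

lemma autFactor_ne_zero (g : SL(2, ℝ)) (z : ℍ) : autFactor g z ≠ 0 := by
  rw [autFactor_eq_denom]
  exact denom_ne_zero _ z

lemma autFactor_cpow_ne_zero (g : SL(2, ℝ)) (z : ℍ) (s : ℂ) : autFactor g z ^ s ≠ 0 := by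
  simp [Complex.cpow_eq_zero_iff, autFactor_ne_zero]

lemma im_autFactor (g : SL(2, ℝ)) (z : ℍ) : (autFactor g z).im = g 1 0 * z.im := by
  simp [autFactor]

lemma mul_apply_fin_two {R : Type*} [CommRing R] (g h : SL(2, R)) (i j : Fin 2) :
    (g * h) i j = g i 0 * h 0 j + g i 1 * h 1 j := by
  simp [mul_apply]

lemma autFactor_mul (g h : SL(2, ℝ)) (z : ℍ) :
    autFactor (g * h) z = autFactor g (h • z) * autFactor h z := by
  have hjz := autFactor_ne_zero h z
  rw [autFactor, autFactor, coe_smul_eq_div_autFactor, add_mul, mul_assoc,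
    div_mul_cancel₀ _ hjz]
  simp only [autFactor, mul_apply_fin_two]
  push_cast
  ring

lemma im_smul_eq_div_norm_autFactor_sq (g : SL(2, ℝ)) (z : ℍ) :
    (g • z).im = z.im / ‖autFactor g z‖ ^ 2 := by
  have := UpperHalfPlane.im_smul_eq_div_normSq (SpecialLinearGroup.mapGL ℝ g) z
  rw [← Complex.normSq_eq_norm_sq, autFactor_eq_denom]
  simp only [SpecialLinearGroup.det_mapGL, Units.val_one, abs_one, one_mul] at this
  exact this

lemma mdifferentiable_log_autFactor (g : SL(2, ℝ)) :
    MDiff fun z : ℍ ↦ Complex.log (autFactor g z) := by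
  rcases eq_or_ne (g 1 0) 0 with hc | hc
  · simp only [autFactor, hc, Complex.ofReal_zero, zero_mul, zero_add]
    exact mdifferentiable_const
  · rw [UpperHalfPlane.mdifferentiable_iff]
    intro z hz
    refine DifferentiableAt.differentiableWithinAt (DifferentiableAt.congr_of_eventuallyEq
      (f := fun w ↦ Complex.log (g 1 0 * w + g 1 1)) ?_ ?_)
    · refine DifferentiableAt.clog (by fun_prop) (Or.inr ?_)
      simpa using And.intro hc (ne_of_gt hz)
    · filter_upwards [isOpen_upperHalfPlaneSet.mem_nhds hz] with w hw
      simp only [Function.comp_apply, autFactor, ofComplex_apply_of_im_pos hw]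

lemma mdifferentiable_smul_comp (g : SL(2, ℝ)) {f : ℍ → ℂ} (hf : MDiff f) :
    MDiff fun z : ℍ ↦ f (g • z) :=
  hf.comp (mdifferentiable_smul (g := SpecialLinearGroup.mapGL ℝ g) (by simp))

lemma mdifferentiable_slash (r : ℝ) (g : SL(2, ℝ)) {f : ℍ → ℂ} (hf : MDiff f) :
    MDiff (slash r g f) := by
  have hpow : MDiff fun z : ℍ ↦ Complex.exp (Complex.log (autFactor g z) * -r) :=
    (Complex.differentiable_exp.mdifferentiable).comp
      ((mdifferentiable_log_autFactor g).mul mdifferentiable_const)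
  have hslash : slash r g f =
      fun z ↦ f (g • z) * Complex.exp (Complex.log (autFactor g z) * -r) := by
    ext z
    rw [slash, div_eq_mul_inv, ← Complex.cpow_neg,
      Complex.cpow_def_of_ne_zero (autFactor_ne_zero g z)]
  rw [hslash]
  exact (mdifferentiable_smul_comp g hf).mul hpow

/- Both sides exponentiate to the same function, so they differ by `2πi` times an integer, which
depends continuously on `z` and is therefore constant. -/
lemma exists_log_autFactor_mul (g h : SL(2, ℝ)) : ∃ n : ℤ, ∀ z : ℍ,
    Complex.log (autFactor g (h • z)) + Complex.log (autFactor h z) =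
      Complex.log (autFactor (g * h) z) + n * (2 * π * I) := by
  have hint (z : ℍ) : ∃ n : ℤ, Complex.log (autFactor g (h • z)) + Complex.log (autFactor h z) =
      Complex.log (autFactor (g * h) z) + n * (2 * π * I) := by
    rw [← Complex.exp_eq_exp_iff_exists_int, Complex.exp_add,
      Complex.exp_log (autFactor_ne_zero _ _), Complex.exp_log (autFactor_ne_zero _ _),
      Complex.exp_log (autFactor_ne_zero _ _), autFactor_mul]
  choose n hn using hint
  have hcont : Continuous n := by
    rw [Int.isClosedEmbedding_coe_real.isInducing.continuous_iff]
    have hquot : (fun z ↦ (n z : ℝ)) = fun z ↦ (Complex.log (autFactor g (h • z)) +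
        Complex.log (autFactor h z) - Complex.log (autFactor (g * h) z)).im / (2 * π) := by
      ext z
      rw [hn, add_sub_cancel_left]
      simp [Real.pi_ne_zero]
    have hlog (k : SL(2, ℝ)) : Continuous fun z : ℍ ↦ Complex.log (autFactor k z) :=
      (mdifferentiable_log_autFactor k).continuous
    have hsmul : Continuous fun z : ℍ ↦ Complex.log (autFactor g (h • z)) :=
      (mdifferentiable_smul_comp h (mdifferentiable_log_autFactor g)).continuous
    change Continuous fun z ↦ (n z : ℝ)
    rw [hquot]
    exact (Complex.continuous_im.comp ((hsmul.add (hlog h)).sub (hlog (g * h)))).div_const _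
  refine ⟨n UpperHalfPlane.I, fun z ↦ ?_⟩
  rw [hn, PreconnectedSpace.constant inferInstance hcont]

lemma slash_slash (r : ℝ) (g h : SL(2, ℝ)) (f : ℍ → ℂ) :
    EqUpToPhase (slash r h (slash r g f)) (slash r (g * h) f) := by
  obtain ⟨n, hn⟩ := exists_log_autFactor_mul g h
  refine ⟨fourierExp (-(n * r)) 1, by simp [norm_fourierExp], fun z ↦ ?_⟩
  simp only [slash, ← mul_smul, div_div, Complex.cpow_def_of_ne_zero (autFactor_ne_zero _ _)]
  rw [← Complex.exp_add, ← add_mul, hn, add_mul, Complex.exp_add, div_mul_eq_div_div,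
    mul_comm, fourierExp, div_eq_mul_inv _ (Complex.exp _), ← Complex.exp_neg]
  push_cast
  ring_nf

lemma norm_slash (r : ℝ) (g : SL(2, ℝ)) (f : ℍ → ℂ) (z : ℍ) :
    ‖slash r g f z‖ = ‖f (g • z)‖ / ‖autFactor g z‖ ^ r := by
  rw [slash, norm_div, Complex.norm_cpow_real]

lemma norm_slash_mul_im_rpow (r : ℝ) (g : SL(2, ℝ)) (f : ℍ → ℂ) (z : ℍ) :
    ‖slash r g f z‖ * z.im ^ (r / 2) = ‖f (g • z)‖ * (g • z).im ^ (r / 2) := by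
  rw [norm_slash, im_smul_eq_div_norm_autFactor_sq, Real.div_rpow z.im_pos.le (by positivity),
    ← Real.rpow_natCast, ← Real.rpow_mul (norm_nonneg _), Nat.cast_two,
    mul_div_cancel₀ _ two_ne_zero]
  ring

end AutFactor

section ModularForm

variable {Γ : Subgroup SL(2, ℤ)} {r : ℝ} {mu : SL(2, ℤ) → ℂ} {f : ℍ → ℂ}

lemma toReal_apply (γ : SL(2, ℤ)) (i j : Fin 2) : toReal γ i j = (γ i j : ℝ) := rfl

lemma toReal_mul (γ δ : SL(2, ℤ)) : toReal (γ * δ) = toReal γ * toReal δ := map_mul _ _ _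

lemma toReal_smul (γ : SL(2, ℤ)) (z : ℍ) : toReal γ • z = γ • z := by
  ext
  rw [coe_specialLinearGroup_apply, coe_specialLinearGroup_apply]
  rfl

namespace IsModularForm

lemma mdifferentiable (hf : IsModularForm Γ r mu f) : MDiff f :=
  UpperHalfPlane.mdifferentiable_iff.2 hf.holo

lemma slash_toReal_of_mem (hf : IsModularForm Γ r mu f) {γ : SL(2, ℤ)} (hγ : γ ∈ Γ) :
    EqUpToPhase (slash r (toReal γ) f) f := by
  refine ⟨mu γ, hf.unimodular γ hγ, fun z ↦ ?_⟩
  have hj := autFactor_cpow_ne_zero (toReal γ) z r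
  rw [slash, toReal_smul, hf.law γ hγ]
  field_simp

lemma slash_toReal (hf : IsModularForm Γ r mu f) {γ : SL(2, ℤ)} (hγ : γ ∈ Γ ∨ -γ ∈ Γ) :
    EqUpToPhase (slash r (toReal γ) f) f := by
  rcases hγ with hγ | hγ
  · exact hf.slash_toReal_of_mem hγ
  · have hneg : EqUpToPhase (slash r (toReal (-1)) f) f := by
      refine ⟨((-1 : ℂ) ^ (r : ℂ))⁻¹, by simp [Complex.norm_cpow_real], fun z ↦ ?_⟩
      have hj : autFactor (toReal (-1)) z = -1 := by simp [autFactor, toReal_apply]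
      rw [slash, hj, toReal_smul, ModularGroup.SL_neg_smul, one_smul, div_eq_inv_mul]
    have hmul : toReal γ = toReal (-γ) * toReal (-1) := by rw [← toReal_mul]; simp
    rw [hmul]
    exact (slash_slash r _ _ f).symm.trans (((hf.slash_toReal_of_mem hγ).slash r _).trans hneg)

lemma norm_mul_im_rpow_smul (hf : IsModularForm Γ r mu f) {γ : SL(2, ℤ)} (hγ : γ ∈ Γ) (z : ℍ) :
    ‖f (γ • z)‖ * (γ • z).im ^ (r / 2) = ‖f z‖ * z.im ^ (r / 2) := by
  rw [← toReal_smul, ← norm_slash_mul_im_rpow, (hf.slash_toReal_of_mem hγ).norm_eq]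

end IsModularForm

end ModularForm

section Growth

variable {g : SL(2, ℝ)} {l : Filter ℍ}

lemma isTheta_autFactor (hg : g 1 0 ≠ 0) (hl : Tendsto UpperHalfPlane.im l atTop)
    (hre : UpperHalfPlane.re =O[l] fun _ ↦ (1 : ℝ)) : autFactor g =Θ[l] UpperHalfPlane.im := by
  have hone : (fun _ ↦ (1 : ℝ)) =O[l] UpperHalfPlane.im :=
    (isLittleO_const_left.2 (Or.inr (tendsto_norm_atTop_atTop.comp hl))).isBigO
  have hcoe : (fun z : ℍ ↦ (z : ℂ)) =O[l] UpperHalfPlane.im := by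
    refine IsBigO.trans (IsBigO.of_norm_le fun z ↦ Complex.norm_le_abs_re_add_abs_im z) ?_
    exact (hre.trans hone).norm_left.add (isBigO_refl _ _).norm_left
  refine ⟨(hcoe.const_mul_left _).add ((isBigO_const_const _ one_ne_zero l).trans hone),
    IsBigO.of_bound |g 1 0|⁻¹ (Eventually.of_forall fun z ↦ ?_)⟩
  rw [← div_eq_inv_mul, le_div_iff₀ (abs_pos.2 hg), mul_comm, Real.norm_eq_abs, ← abs_mul,
    ← im_autFactor]
  exact Complex.abs_im_le_norm _

lemma isTheta_im_smul (hg : g 1 0 ≠ 0) (hl : Tendsto UpperHalfPlane.im l atTop)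
    (hre : UpperHalfPlane.re =O[l] fun _ ↦ (1 : ℝ)) :
    (fun z ↦ (g • z).im) =Θ[l] fun z ↦ (z.im)⁻¹ := by
  have him : (fun z : ℍ ↦ z.im⁻¹) = fun z ↦ z.im / z.im ^ 2 := by
    ext z
    have := z.im_ne_zero
    field_simp
  simp only [im_smul_eq_div_norm_autFactor_sq, him]
  exact (isTheta_refl UpperHalfPlane.im l).div ((isTheta_autFactor hg hl hre).norm_left.pow 2)

lemma IsModularForm.exists_isBigO_slash {Γ : Subgroup SL(2, ℤ)} {r : ℝ} {mu : SL(2, ℤ) → ℂ}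
    {f : ℍ → ℂ} (hf : IsModularForm Γ r mu f) (hg : g 1 0 ≠ 0)
    (hl : Tendsto UpperHalfPlane.im l atTop) (hre : UpperHalfPlane.re =O[l] fun _ ↦ (1 : ℝ)) :
    ∃ K : ℝ, slash r g f =O[l] fun z ↦ z.im ^ K := by
  obtain ⟨C, K, δ, hδ, hgrowth⟩ := hf.growth
  have hpos : 0 ≤ᶠ[l] fun z : ℍ ↦ z.im⁻¹ :=
    Eventually.of_forall fun z ↦ inv_nonneg.2 z.im_pos.le
  have him := isTheta_im_smul hg hl hre
  have hsmall : Tendsto (fun z ↦ (g • z).im) l (𝓝 0) :=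
    him.isBigO.trans_tendsto (tendsto_inv_atTop_zero.comp hl)
  have hf_smul : (fun z ↦ f (g • z)) =O[l] fun z ↦ z.im⁻¹ ^ (-K) := by
    refine IsBigO.trans (IsBigO.of_bound C ?_)
      (him.rpow (r := -K) (Eventually.of_forall fun z ↦ (g • z).im_pos.le) hpos).isBigO
    filter_upwards [hsmall.eventually_lt_const hδ] with z hz
    rw [Real.norm_of_nonneg (Real.rpow_nonneg (g • z).im_pos.le _)]
    exact hgrowth _ hz
  have hj : (fun z ↦ ‖autFactor g z‖ ^ r) =Θ[l] fun z ↦ z.im ^ r :=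
    (isTheta_autFactor hg hl hre).norm_left.rpow (Eventually.of_forall fun z ↦ norm_nonneg _)
      (Eventually.of_forall fun z ↦ z.im_pos.le)
  refine ⟨K - r, ((hf_smul.norm_left.mul hj.inv.isBigO).congr (fun z ↦ ?_) fun z ↦ ?_).of_norm_left⟩
  · exact (norm_slash r g f z).symm
  · rw [Real.inv_rpow z.im_pos.le, Real.rpow_neg z.im_pos.le, inv_inv, Real.rpow_sub z.im_pos,
      div_eq_mul_inv]

end Growth

/-! ### Cusps and scaling matrices -/

section CuspWidth

lemma smul_infty_eq_infty_iff (γ : SL(2, ℤ)) :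
    SpecialLinearGroup.mapGL ℚ γ • (OnePoint.infty : OnePoint ℚ) = OnePoint.infty ↔
      γ 1 0 = 0 := by
  rw [OnePoint.smul_infty_eq_self_iff]
  simp

lemma mem_cuspStabilizer_smul_infty_iff (γ δ : SL(2, ℤ)) :
    δ ∈ cuspStabilizer (SpecialLinearGroup.mapGL ℚ γ • (OnePoint.infty : OnePoint ℚ)) ↔
      (γ⁻¹ * δ * γ) 1 0 = 0 := by
  rw [← smul_infty_eq_infty_iff, cuspStabilizer, Subgroup.mem_comap,
    MulAction.mem_stabilizer_iff, map_mul, map_mul, mul_smul, mul_smul, map_inv, inv_smul_eq_iff]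

lemma apply_zero_zero_mul_apply_one_one {γ : SL(2, ℤ)} (hγ : γ 1 0 = 0) :
    γ 0 0 * γ 1 1 = 1 := by
  have := γ.det_coe
  rwa [det_fin_two, hγ, mul_zero, sub_zero] at this

lemma mul_comm_of_apply_one_zero_eq_zero {γ δ : SL(2, ℤ)} (hγ : γ 1 0 = 0) (hδ : δ 1 0 = 0) :
    γ * δ = δ * γ := by
  have hγ' := Int.eq_of_mul_eq_one (apply_zero_zero_mul_apply_one_one hγ)
  have hδ' := Int.eq_of_mul_eq_one (apply_zero_zero_mul_apply_one_one hδ)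
  ext i j
  fin_cases i <;> fin_cases j <;> simp [mul_apply_fin_two, hγ, hδ, hγ', hδ'] <;> ring

lemma normal_subgroupOf_cuspStabilizer (H : Subgroup SL(2, ℤ)) (γ : SL(2, ℤ)) :
    (H.subgroupOf (cuspStabilizer
      (SpecialLinearGroup.mapGL ℚ γ • (OnePoint.infty : OnePoint ℚ)))).Normal := by
  refine ⟨fun n hn g ↦ ?_⟩
  have hcomm : MulAut.conj γ⁻¹ (g.1 * n.1) = MulAut.conj γ⁻¹ (n.1 * g.1) := by
    rw [map_mul, map_mul]
    apply mul_comm_of_apply_one_zero_eq_zero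
    · simpa using (mem_cuspStabilizer_smul_infty_iff γ _).1 g.2
    · simpa using (mem_cuspStabilizer_smul_infty_iff γ _).1 n.2
  rwa [show g * n = n * g from Subtype.ext ((MulAut.conj γ⁻¹).injective hcomm),
    mul_inv_cancel_right]

instance (Γ : Subgroup SL(2, ℤ)) [Γ.FiniteIndex] (𝔞 : OnePoint ℚ) : NeZero (cuspWidth Γ 𝔞) :=
  have : (Γ ⊔ Subgroup.zpowers (-1)).FiniteIndex := Subgroup.finiteIndex_of_le le_sup_left
  ⟨Subgroup.FiniteIndex.index_ne_zero
    (H := (Γ ⊔ Subgroup.zpowers (-1)).subgroupOf (cuspStabilizer 𝔞))⟩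

lemma mem_or_neg_mem_of_mem_sup {Γ : Subgroup SL(2, ℤ)} {δ : SL(2, ℤ)}
    (hδ : δ ∈ Γ ⊔ Subgroup.zpowers (-1)) : δ ∈ Γ ∨ -δ ∈ Γ := by
  have : (Subgroup.zpowers (-1 : SL(2, ℤ))).Normal := ⟨fun ε hε g ↦ by
    obtain ⟨k, rfl⟩ := Subgroup.mem_zpowers_iff.1 hε
    rwa [((Commute.neg_one_right g).zpow_right k).eq, mul_inv_cancel_right]⟩
  obtain ⟨γ, hγ, ε, hε, rfl⟩ := Subgroup.mem_sup_of_normal_right.1 hδ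
  obtain ⟨k, rfl⟩ := Subgroup.mem_zpowers_iff.1 hε
  rcases Int.even_or_odd k with hk | hk
  · left
    simpa [hk.neg_one_zpow] using hγ
  · right
    simpa [hk.neg_one_zpow] using hγ

/-- The conjugate of `z ↦ z + m` by `γ`. It fixes the cusp `γ ∞`, and for `m` the width of this
cusp it lies in `Γ` up to sign. -/
def parabolic (γ : SL(2, ℤ)) (m : ℕ) : SL(2, ℤ) := γ * ModularGroup.T ^ m * γ⁻¹

lemma parabolic_mem_or_neg_mem (Γ : Subgroup SL(2, ℤ)) {γ : SL(2, ℤ)} {𝔞 : OnePoint ℚ}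
    (hγ : SpecialLinearGroup.mapGL ℚ γ • (OnePoint.infty : OnePoint ℚ) = 𝔞) :
    parabolic γ (cuspWidth Γ 𝔞) ∈ Γ ∨ -parabolic γ (cuspWidth Γ 𝔞) ∈ Γ := by
  subst hγ
  apply mem_or_neg_mem_of_mem_sup
  set 𝔞 : OnePoint ℚ := SpecialLinearGroup.mapGL ℚ γ • OnePoint.infty with h𝔞
  have := normal_subgroupOf_cuspStabilizer (Γ ⊔ Subgroup.zpowers (-1)) γ
  have hstab : γ * ModularGroup.T * γ⁻¹ ∈ cuspStabilizer 𝔞 := by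
    rw [h𝔞, mem_cuspStabilizer_smul_infty_iff,
      show γ⁻¹ * (γ * ModularGroup.T * γ⁻¹) * γ = ModularGroup.T by group]
    simp [ModularGroup.T]
  rw [parabolic, ← conj_pow]
  exact Subgroup.mem_subgroupOf.1 (Subgroup.pow_index_mem
    ((Γ ⊔ Subgroup.zpowers (-1)).subgroupOf (cuspStabilizer 𝔞)) ⟨_, hstab⟩)

lemma coe_T_pow (m : ℕ) : ((ModularGroup.T ^ m : SL(2, ℤ)) : Matrix (Fin 2) (Fin 2) ℤ)
    = !![1, (m : ℤ); 0, 1] := by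
  rw [← ModularGroup.coe_T_zpow, zpow_natCast]

lemma exists_mem_mul_apply_one_zero_ne_zero (Γ : Subgroup SL(2, ℤ)) [Γ.FiniteIndex]
    (γ : SL(2, ℤ)) : ∃ δ ∈ Γ, (δ * γ) 1 0 ≠ 0 := by
  by_cases hγ : γ 1 0 = 0
  · obtain ⟨n, hn, -, hmem⟩ := Subgroup.exists_pow_mem_of_index_ne_zero
      (Subgroup.FiniteIndex.index_ne_zero (H := Γ)) (ModularGroup.S * ModularGroup.T *
        ModularGroup.S⁻¹)
    refine ⟨_, hmem, ?_⟩
    have hlower : (ModularGroup.S * ModularGroup.T ^ n * ModularGroup.S⁻¹) 1 0 = -(n : ℤ) := by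
      simp only [mul_apply_fin_two, coe_T_pow, ModularGroup.coe_S]
      simp
    rw [conj_pow, mul_apply_fin_two, hγ, hlower, mul_zero, add_zero]
    exact mul_ne_zero (by simpa using hn.ne')
      (left_ne_zero_of_mul_eq_one (apply_zero_zero_mul_apply_one_one hγ))
  · exact ⟨1, Γ.one_mem, by rwa [one_mul]⟩

lemma exists_normalized_sign (γ : SL(2, ℤ)) : ∃ γ' : SL(2, ℤ), (γ' = γ ∨ γ' = -γ) ∧
    (γ' 1 0 < 0 ∨ (γ' 1 0 = 0 ∧ γ' 1 1 = 1)) := by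
  rcases lt_trichotomy (γ 1 0) 0 with hc | hc | hc
  · exact ⟨γ, Or.inl rfl, Or.inl hc⟩
  · rcases Int.eq_one_or_neg_one_of_mul_eq_one' (apply_zero_zero_mul_apply_one_one hc) with
      ⟨-, hd⟩ | ⟨-, hd⟩
    · exact ⟨γ, Or.inl rfl, Or.inr ⟨hc, hd⟩⟩
    · exact ⟨-γ, Or.inr rfl, Or.inr ⟨by simp [hc], by simp [hd]⟩⟩
  · exact ⟨-γ, Or.inr rfl, Or.inl (by simpa using hc)⟩

end CuspWidth

section ScalingDiag

variable (m : ℕ) [NeZero m]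

lemma sqrt_natCast_pos : 0 < √(m : ℝ) := Real.sqrt_pos.2 (Nat.cast_pos.2 (NeZero.pos m))

/-- The diagonal factor `(√m, 0; 0, 1 / √m)` of a scaling matrix; it acts as `z ↦ m z`. -/
def scalingDiag : SL(2, ℝ) :=
  ⟨!![√(m : ℝ), 0; 0, 1 / √(m : ℝ)], by simp [det_fin_two, (sqrt_natCast_pos m).ne']⟩

lemma autFactor_scalingDiag (z : ℍ) : autFactor (scalingDiag m) z = (1 / √(m : ℝ) : ℝ) := by
  simp [autFactor, scalingDiag]

lemma coe_scalingDiag_smul (z : ℍ) : ((scalingDiag m • z : ℍ) : ℂ) = m * z := by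
  have hm : (√(m : ℝ) : ℂ) * √(m : ℝ) = m := by
    rw [← Complex.ofReal_mul, Real.mul_self_sqrt m.cast_nonneg, Complex.ofReal_natCast]
  rw [coe_smul_eq_div_autFactor, autFactor_scalingDiag, ← hm]
  simp [scalingDiag]
  ring

lemma im_scalingDiag_smul (z : ℍ) : (scalingDiag m • z).im = m * z.im := by
  rw [← coe_im, coe_scalingDiag_smul, ← nsmul_eq_mul, Complex.smul_im, nsmul_eq_mul, coe_im]

lemma scalingDiag_mul_T :
    scalingDiag m * toReal ModularGroup.T = toReal (ModularGroup.T ^ m) * scalingDiag m := by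
  have hm : √(m : ℝ) * √(m : ℝ) = m := Real.mul_self_sqrt m.cast_nonneg
  have hs := (sqrt_natCast_pos m).ne'
  ext i j
  rw [mul_apply_fin_two, mul_apply_fin_two]
  simp only [toReal_apply, coe_T_pow, ModularGroup.coe_T, scalingDiag]
  fin_cases i <;> fin_cases j <;> simp
  field_simp
  linarith

lemma tendsto_inv_scalingDiag_smul :
    Tendsto (fun z : ℍ ↦ (scalingDiag m)⁻¹ • z) atImInfty atImInfty := by
  have hm : (0 : ℝ) < m := Nat.cast_pos.2 (NeZero.pos m)
  refine tendsto_comap_iff.2 ((tendsto_im_atImInfty.atTop_div_const hm).congr fun z ↦ ?_)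
  rw [div_eq_iff hm.ne', Function.comp_apply, mul_comm, ← im_scalingDiag_smul, smul_inv_smul]

lemma dilate_eq_comp_scalingDiag (f : ℍ → ℂ) : dilate m f = fun z ↦ f (scalingDiag m • z) := by
  ext z
  rw [dilate, ← coe_scalingDiag_smul, ofComplex_apply]

lemma exists_dilate_eq_const_mul_slash (r : ℝ) (f : ℍ → ℂ) :
    ∃ b : ℂ, b ≠ 0 ∧ dilate m f = fun z ↦ b * slash r (scalingDiag m) f z := by
  refine ⟨autFactor (scalingDiag m) UpperHalfPlane.I ^ (r : ℂ), autFactor_cpow_ne_zero _ _ _, ?_⟩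
  ext z
  rw [slash, dilate_eq_comp_scalingDiag, autFactor_scalingDiag, ← autFactor_scalingDiag m z,
    mul_div_cancel₀ _ (autFactor_cpow_ne_zero _ _ _)]

end ScalingDiag

section Scaling

variable {Γ : Subgroup SL(2, ℤ)} [Γ.FiniteIndex] {𝔞 : OnePoint ℚ} {σ : SL(2, ℝ)}

lemma isScalingMatrix_iff : IsScalingMatrix Γ 𝔞 σ ↔ ∃ γ : SL(2, ℤ),
    SpecialLinearGroup.mapGL ℚ γ • (OnePoint.infty : OnePoint ℚ) = 𝔞 ∧
    (γ 1 0 < 0 ∨ (γ 1 0 = 0 ∧ γ 1 1 = 1)) ∧ σ = toReal γ * scalingDiag (cuspWidth Γ 𝔞) := by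
  exact exists_congr fun γ ↦ and_congr_right' (and_congr_right'
    (Subtype.ext_iff (a1 := σ) (a2 := toReal γ * scalingDiag (cuspWidth Γ 𝔞))).symm)

lemma isScalingMatrix_infty : IsScalingMatrix Γ OnePoint.infty
    (scalingDiag (cuspWidth Γ OnePoint.infty)) :=
  isScalingMatrix_iff.2 ⟨1, by simp, Or.inr (by simp), by simp [toReal]⟩

end Scaling

section CuspParam

lemma exists_fourierExp_one_eq {ω : ℂ} (hω : ‖ω‖ = 1) :
    ∃ κ : ℝ, 0 ≤ κ ∧ κ < 1 ∧ fourierExp κ 1 = ω := by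
  refine ⟨Int.fract (ω.arg / (2 * π)), Int.fract_nonneg _, Int.fract_lt_one _, ?_⟩
  have harg : Complex.exp (ω.arg * I) = ω := by
    simpa [hω] using Complex.norm_mul_exp_arg_mul_I ω
  rw [fourierExp]
  conv_rhs => rw [← harg]
  rw [Complex.exp_eq_exp_iff_exists_int]
  refine ⟨-⌊ω.arg / (2 * π)⌋, ?_⟩
  have : (π : ℂ) ≠ 0 := by exact_mod_cast Real.pi_ne_zero
  rw [← Int.self_sub_floor]
  push_cast
  field_simp
  ring

lemma cuspParam_spec {g : ℍ → ℂ} (hg : EqUpToPhase (fun z ↦ g ((1 : ℝ) +ᵥ z)) g) :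
    0 ≤ cuspParam g ∧ cuspParam g < 1 ∧ IsTwisted (cuspParam g) g := by
  obtain ⟨ω, hω, htwist⟩ := hg
  obtain ⟨κ, h₀, h₁, rfl⟩ := exists_fourierExp_one_eq hω
  have := Classical.epsilon_spec (p := fun κ : ℝ ↦ 0 ≤ κ ∧ κ < 1 ∧ ∀ z : ℍ,
    g ((1 : ℝ) +ᵥ z) = Complex.exp (2 * π * I * κ) * g z)
    ⟨κ, h₀, h₁, fun z ↦ by simpa [fourierExp] using htwist z⟩
  simpa only [cuspParam, IsTwisted, fourierExp, mul_one] using this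

lemma cuspParam_const_mul {b : ℂ} (hb : b ≠ 0) (g : ℍ → ℂ) :
    cuspParam (fun z ↦ b * g z) = cuspParam g := by
  simp only [cuspParam, mul_left_comm _ b, mul_right_inj' hb]

lemma fourierCoef_eq_twistedCoef {g : ℍ → ℂ} (hg : IsTwisted (cuspParam g) g) (hol : MDiff g)
    (hb : IsBoundedAtImInfty (untwist (cuspParam g) g)) (n : ℕ) :
    fourierCoef g n = twistedCoef (cuspParam g) g n := by
  rw [twistedCoef_eq_integral hg hol hb n one_pos, fourierCoef]
  refine intervalIntegral.integral_congr fun x _ ↦ ?_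
  simp only [fourierExp]
  push_cast
  ring_nf

end CuspParam

/-! ### Boundedness of cusp forms -/

lemma exists_vadd_re_le_one {g : ℍ → ℂ} (hg : ∀ z : ℍ, ‖g ((1 : ℝ) +ᵥ z)‖ = ‖g z‖) (z : ℍ) :
    ∃ w : ℍ, |w.re| ≤ 1 ∧ w.im = z.im ∧ ‖g w‖ = ‖g z‖ := by
  have hper : Function.Periodic (fun x : ℝ ↦ ‖g (x +ᵥ z)‖) 1 := fun x ↦ by
    change ‖g ((x + 1) +ᵥ z)‖ = ‖g (x +ᵥ z)‖
    rw [add_comm, add_vadd, hg]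
  refine ⟨(-⌊z.re⌋ : ℝ) +ᵥ z, ?_, by simp, ?_⟩
  · rw [vadd_re, neg_add_eq_sub, Int.self_sub_floor, abs_of_nonneg (Int.fract_nonneg _)]
    exact (Int.fract_lt_one _).le
  · simpa using hper.int_mul_eq (-⌊z.re⌋)

lemma isBigO_atImInfty_of_strip {g : ℍ → ℂ} (hg : ∀ z : ℍ, ‖g ((1 : ℝ) +ᵥ z)‖ = ‖g z‖) {K : ℝ}
    (hstrip : g =O[atImInfty ⊓ 𝓟 {z | |z.re| ≤ 1}] fun z ↦ z.im ^ K) :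
    g =O[atImInfty] fun z ↦ z.im ^ K := by
  obtain ⟨C, hC⟩ := hstrip.bound
  obtain ⟨Y, hY⟩ := (atImInfty_mem _).1 (eventually_inf_principal.1 hC)
  refine IsBigO.of_bound C ((atImInfty_mem _).2 ⟨Y, fun z hz ↦ ?_⟩)
  obtain ⟨w, hre, him, hnorm⟩ := exists_vadd_re_le_one hg z
  have := hY w (him ▸ hz) hre
  rwa [hnorm, him] at this

section CuspForm

variable {Γ : Subgroup SL(2, ℤ)} [Γ.FiniteIndex] {r : ℝ} {mu : SL(2, ℤ) → ℂ} {f : ℍ → ℂ}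
  {𝔞 : OnePoint ℚ} {σ : SL(2, ℝ)}

lemma slash_T (r : ℝ) (g : ℍ → ℂ) :
    slash r (toReal ModularGroup.T) g = fun z ↦ g ((1 : ℝ) +ᵥ z) := by
  ext z
  have hj : autFactor (toReal ModularGroup.T) z = 1 := by
    rw [autFactor, toReal_apply, toReal_apply]
    simp [ModularGroup.T]
  rw [slash, hj, Complex.one_cpow, div_one, toReal_smul, modular_T_smul]

namespace IsModularForm

lemma slash_vadd (hf : IsModularForm Γ r mu f) (hσ : IsScalingMatrix Γ 𝔞 σ) :
    EqUpToPhase (fun z ↦ slash r σ f ((1 : ℝ) +ᵥ z)) (slash r σ f) := by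
  obtain ⟨γ, hγ, -, rfl⟩ := isScalingMatrix_iff.1 hσ
  have hmul : toReal γ * scalingDiag (cuspWidth Γ 𝔞) * toReal ModularGroup.T =
      toReal (parabolic γ (cuspWidth Γ 𝔞)) * (toReal γ * scalingDiag (cuspWidth Γ 𝔞)) := by
    rw [mul_assoc, scalingDiag_mul_T, ← mul_assoc, ← mul_assoc, ← toReal_mul, ← toReal_mul,
      parabolic, inv_mul_cancel_right]
  rw [← slash_T r]
  refine (slash_slash r _ _ f).trans ?_
  rw [hmul]
  exact (slash_slash r _ _ f).symm.trans
    ((hf.slash_toReal (parabolic_mem_or_neg_mem Γ hγ)).slash r _)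

/- The cusp may be moved by an element of `Γ` to a finite one, where the growth hypothesis
applies. -/
lemma exists_isBigO_slash_atImInfty (hf : IsModularForm Γ r mu f)
    (hσ : IsScalingMatrix Γ 𝔞 σ) : ∃ K : ℝ, slash r σ f =O[atImInfty] fun z ↦ z.im ^ K := by
  obtain ⟨γ, -, -, hγσ⟩ := isScalingMatrix_iff.1 hσ
  obtain ⟨δ, hδ, hne⟩ := exists_mem_mul_apply_one_zero_ne_zero Γ γ
  have hδσ : (toReal δ * σ) 1 0 ≠ 0 := by
    rw [hγσ, ← mul_assoc, ← toReal_mul, mul_apply_fin_two]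
    simpa [scalingDiag, toReal_apply] using And.intro hne (NeZero.ne (cuspWidth Γ 𝔞))
  have hphase : EqUpToPhase (slash r σ f) (slash r (toReal δ * σ) f) :=
    ((hf.slash_toReal_of_mem hδ).slash r σ).symm.trans (slash_slash r _ _ f)
  obtain ⟨K, hK⟩ := hf.exists_isBigO_slash hδσ
    (l := atImInfty ⊓ 𝓟 {z | |z.re| ≤ 1}) (tendsto_im_atImInfty.mono_left inf_le_left)
    (IsBigO.of_bound 1 (eventually_inf_principal.2 (Eventually.of_forall fun z hz ↦ by
      simpa using hz)))
  exact ⟨K, isBigO_atImInfty_of_strip (hf.slash_vadd hσ).norm_eq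
    (hK.norm_left.congr_left fun z ↦ (hphase.norm_eq z).symm).of_norm_left⟩

end IsModularForm

namespace IsCuspForm

lemma isBigO_slash (hf : IsCuspForm Γ r mu f) (hσ : IsScalingMatrix Γ 𝔞 σ) (s : ℝ) :
    slash r σ f =O[atImInfty] fun z ↦ z.im ^ s := by
  obtain ⟨h₀, h₁, htwist⟩ := cuspParam_spec (hf.slash_vadd hσ)
  have hol := mdifferentiable_slash r σ hf.mdifferentiable
  obtain ⟨K, hK⟩ := hf.exists_isBigO_slash_atImInfty hσ
  have hb := isBoundedAtImInfty_untwist h₁ htwist hol hK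
  have hcusp := hf.cuspidal 𝔞 σ hσ
  rw [fourierCoef_eq_twistedCoef htwist hol hb] at hcusp
  exact isBigO_rpow_of_cuspidal h₀ htwist hol hb hcusp s

lemma isBigO_norm_mul_im_rpow_smul (hf : IsCuspForm Γ r mu f) (γ : SL(2, ℤ)) :
    (fun z : ℍ ↦ ‖f (γ • z)‖ * (γ • z).im ^ (r / 2)) =O[atImInfty] fun _ ↦ (1 : ℝ) := by
  obtain ⟨γ', hγ', hnormalized⟩ := exists_normalized_sign γ
  have hsmul (z : ℍ) : γ • z = γ' • z := by
    rcases hγ' with h | h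
    · rw [h]
    · rw [h, ModularGroup.SL_neg_smul]
  set m := cuspWidth Γ (SpecialLinearGroup.mapGL ℚ γ' • (OnePoint.infty : OnePoint ℚ))
  have hO : (fun w : ℍ ↦ ‖slash r (toReal γ' * scalingDiag m) f w‖ * w.im ^ (r / 2))
      =O[atImInfty] fun w ↦ w.im ^ (-(r / 2)) * w.im ^ (r / 2) :=
    (hf.isBigO_slash (isScalingMatrix_iff.2 ⟨γ', rfl, hnormalized, rfl⟩) _).norm_left.mul
      (isBigO_refl _ _)
  refine (hO.comp_tendsto (tendsto_inv_scalingDiag_smul m)).congr (fun z ↦ ?_) fun z ↦ ?_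
  · rw [Function.comp_apply, norm_slash_mul_im_rpow, mul_smul, smul_inv_smul, toReal_smul, hsmul]
  · rw [Function.comp_apply, ← Real.rpow_add (im_pos _), neg_add_cancel, Real.rpow_zero]

lemma exists_norm_mul_im_rpow_le (hf : IsCuspForm Γ r mu f) :
    ∃ C : ℝ, ∀ z : ℍ, ‖f z‖ * z.im ^ (r / 2) ≤ C := by
  have hcont : Continuous fun z : ℍ ↦ ‖f z‖ * z.im ^ (r / 2) :=
    hf.mdifferentiable.continuous.norm.mul
      (continuous_im.rpow_const fun z ↦ Or.inl z.im_ne_zero)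
  obtain ⟨C, hC⟩ := ModularGroup.exists_bound_of_subgroup_invariant_of_isBigO hcont le_rfl
    (fun γ ↦ by simpa only [Real.rpow_zero] using hf.isBigO_norm_mul_im_rpow_smul γ)
    fun γ hγ z ↦ hf.norm_mul_im_rpow_smul hγ z
  exact ⟨C, fun z ↦ by simpa using (le_abs_self _).trans (hC z)⟩

lemma exists_isTwistedForm_slash (hr : 0 < r) (hf : IsCuspForm Γ r mu f)
    (hσ : IsScalingMatrix Γ 𝔞 σ) :
    ∃ C, IsTwistedForm (cuspParam (slash r σ f)) (r / 2) C (slash r σ f) := by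
  obtain ⟨C, hC⟩ := hf.exists_norm_mul_im_rpow_le
  obtain ⟨h₀, h₁, htwist⟩ := cuspParam_spec (hf.slash_vadd hσ)
  refine ⟨C, htwist, mdifferentiable_slash r σ hf.mdifferentiable, h₀, h₁, half_pos hr,
    fun z ↦ ?_⟩
  rw [Real.rpow_neg z.im_pos.le, ← div_eq_mul_inv, le_div_iff₀ (Real.rpow_pos_of_pos z.im_pos _),
    norm_slash_mul_im_rpow]
  exact hC _

lemma exists_isTwistedForm_dilate (hr : 0 < r) (hf : IsCuspForm Γ r mu f) :
    ∃ C, IsTwistedForm (cuspParam (dilate (cuspWidth Γ OnePoint.infty) f)) (r / 2) C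
      (dilate (cuspWidth Γ OnePoint.infty) f) := by
  obtain ⟨b, hb, hdilate⟩ :=
    exists_dilate_eq_const_mul_slash (cuspWidth Γ OnePoint.infty) r f
  obtain ⟨C, hC⟩ := hf.exists_isTwistedForm_slash hr isScalingMatrix_infty
  rw [hdilate, cuspParam_const_mul hb]
  exact ⟨_, hC.const_mul b⟩

end IsCuspForm

end CuspForm

/-! ### Complex powers and primitives on the upper half-plane -/

lemma ne_zero_of_im_pos {W : ℂ} (hW : 0 < W.im) : W ≠ 0 := by
  rintro rfl
  exact hW.ne' Complex.zero_im

lemma log_ofReal_mul_of_im_pos {a : ℝ} (ha : a ≠ 0) {W : ℂ} (hW : 0 < W.im) :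
    Complex.log (a * W) = 2 * (Real.log |a| : ℂ) - Complex.log a + Complex.log W := by
  have hW0 : W ≠ 0 := ne_zero_of_im_pos hW
  rcases lt_or_gt_of_ne ha with h | h
  · have h' : 0 < |a| := abs_pos.2 ha
    have hprod : (a : ℂ) * W = (|a| : ℝ) * -W := by
      rw [abs_of_neg h]
      push_cast
      ring
    have hneg : Complex.log (-W) = Complex.log W - π * I := by
      rw [Complex.log, Complex.log, Complex.arg_neg_eq_arg_sub_pi_of_im_pos hW, norm_neg]
      push_cast
      ring
    have hloga : Complex.log a = (Real.log |a| : ℂ) + π * I := by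
      rw [Complex.log, Complex.arg_ofReal_of_neg h, Complex.norm_real, Real.norm_eq_abs]
    rw [hprod, Complex.log_ofReal_mul h' (neg_ne_zero.2 hW0), hneg, hloga]
    ring
  · rw [Complex.log_ofReal_mul h hW0, abs_of_pos h, ← Complex.ofReal_log h.le]
    ring

lemma ofReal_mul_cpow_of_im_pos {a : ℝ} (ha : a ≠ 0) {W : ℂ} (hW : 0 < W.im) (s : ℂ) :
    ((a : ℂ) * W) ^ s = ((|a| : ℝ) : ℂ) ^ (2 * s) * (a : ℂ) ^ (-s) * W ^ s := by
  have ha' : (a : ℂ) ≠ 0 := Complex.ofReal_ne_zero.2 ha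
  have habs : ((|a| : ℝ) : ℂ) ≠ 0 := Complex.ofReal_ne_zero.2 (abs_ne_zero.2 ha)
  have hW0 : W ≠ 0 := ne_zero_of_im_pos hW
  rw [Complex.cpow_def_of_ne_zero (mul_ne_zero ha' hW0), Complex.cpow_def_of_ne_zero habs,
    Complex.cpow_def_of_ne_zero ha', Complex.cpow_def_of_ne_zero hW0,
    log_ofReal_mul_of_im_pos ha hW, Complex.ofReal_log (abs_nonneg a), ← Complex.exp_add,
    ← Complex.exp_add]
  ring_nf

lemma ofReal_mul_cpow {a : ℝ} (ha : 0 < a) {W : ℂ} (hW : W ≠ 0) (s : ℂ) :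
    ((a : ℂ) * W) ^ s = (a : ℂ) ^ s * W ^ s := by
  have ha' : (a : ℂ) ≠ 0 := Complex.ofReal_ne_zero.2 ha.ne'
  rw [Complex.cpow_def_of_ne_zero (mul_ne_zero ha' hW), Complex.cpow_def_of_ne_zero ha',
    Complex.cpow_def_of_ne_zero hW, Complex.log_ofReal_mul ha hW, Complex.ofReal_log ha.le,
    ← Complex.exp_add, add_mul]

lemma mul_cpow_of_im_pos_of_im_neg {a b : ℂ} (ha : 0 < a.im) (hb : b.im < 0) (s : ℂ) :
    (a * b) ^ s = a ^ s * b ^ s := by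
  have ha0 : a ≠ 0 := ne_zero_of_im_pos ha
  have hb0 : b ≠ 0 := fun h ↦ hb.ne (h ▸ Complex.zero_im)
  have harg_a : 0 ≤ a.arg := Complex.arg_nonneg_iff.2 ha.le
  have harg_b : b.arg < 0 := Complex.arg_neg_iff.2 hb
  have hab : a.arg + b.arg ∈ Set.Ioc (-π) π := by
    refine ⟨?_, by linarith [Complex.arg_le_pi a]⟩
    linarith [Complex.neg_pi_lt_arg b]
  rw [Complex.cpow_def_of_ne_zero (mul_ne_zero ha0 hb0), Complex.cpow_def_of_ne_zero ha0,
    Complex.cpow_def_of_ne_zero hb0, ← Complex.exp_add,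
    (Complex.log_mul_eq_add_log_iff ha0 hb0).2 hab, add_mul]

lemma im_inv_cayley_pos {w : ℂ} (hw : ‖w‖ < 1) : 0 < (I * (1 + w) / (1 - w)).im := by
  have hw1 : 1 - w ≠ 0 := by
    intro h
    simp [← sub_eq_zero.1 h] at hw
  have hsq : w.re * w.re + w.im * w.im < 1 := by
    rw [← Complex.normSq_apply, Complex.normSq_eq_norm_sq]
    exact pow_lt_one₀ (norm_nonneg w) hw two_ne_zero
  have him : (I * (1 + w) / (1 - w)).im =
      (1 - (w.re * w.re + w.im * w.im)) / Complex.normSq (1 - w) := by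
    rw [Complex.div_im]
    simp only [Complex.mul_re, Complex.mul_im, Complex.I_re, Complex.I_im, Complex.add_re,
      Complex.add_im, Complex.sub_re, Complex.sub_im, Complex.one_re, Complex.one_im]
    ring
  rw [him]
  exact div_pos (sub_pos.2 hsq) (Complex.normSq_pos.2 hw1)

lemma norm_cayley_lt_one {z : ℂ} (hz : 0 < z.im) : ‖(z - I) / (z + I)‖ < 1 := by
  have hzI : z + I ≠ 0 := ne_zero_of_im_pos (by rw [Complex.add_im, Complex.I_im]; linarith)
  rw [norm_div, div_lt_one (norm_pos_iff.2 hzI), ← sq_lt_sq₀ (norm_nonneg _) (norm_nonneg _),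
    ← Complex.normSq_eq_norm_sq, ← Complex.normSq_eq_norm_sq, Complex.normSq_apply,
    Complex.normSq_apply]
  simp only [Complex.sub_re, Complex.sub_im, Complex.add_re, Complex.add_im, Complex.I_re,
    Complex.I_im]
  linarith

lemma exists_hasDerivAt_of_differentiableOn_im_pos {Φ : ℂ → ℂ}
    (hΦ : DifferentiableOn ℂ Φ {z | 0 < z.im}) :
    ∃ P : ℂ → ℂ, ∀ z : ℂ, 0 < z.im → HasDerivAt P (Φ z) z := by
  -- Pull back to the unit disc, which is a ball, by the inverse Cayley transform.
  have hdisc : DifferentiableOn ℂ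
      (fun w ↦ Φ (I * (1 + w) / (1 - w)) * (2 * I / (1 - w) ^ 2)) (Metric.ball 0 1) := by
    have hone : ∀ w ∈ Metric.ball (0 : ℂ) 1, 1 - w ≠ 0 := by
      rintro w hw h
      simp [← sub_eq_zero.1 h] at hw
    refine (hΦ.comp ?_ fun w hw ↦ im_inv_cayley_pos (mem_ball_zero_iff.1 hw)).mul ?_
    · exact DifferentiableOn.div (by fun_prop) (by fun_prop) hone
    · exact DifferentiableOn.div (by fun_prop) (by fun_prop) fun w hw ↦ pow_ne_zero 2 (hone w hw)
  obtain ⟨Q, hQ⟩ := hdisc.isExactOn_ball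
  refine ⟨fun z ↦ Q ((z - I) / (z + I)), fun z hz ↦ ?_⟩
  have hzI : z + I ≠ 0 := ne_zero_of_im_pos (by rw [Complex.add_im, Complex.I_im]; linarith)
  have hcayley : HasDerivAt (fun z : ℂ ↦ (z - I) / (z + I)) (2 * I / (z + I) ^ 2) z := by
    refine (((hasDerivAt_id z).sub_const I).div ((hasDerivAt_id z).add_const I) hzI).congr_deriv ?_
    simp only [id_eq]
    ring
  have hQz := hQ _ (mem_ball_zero_iff.2 (norm_cayley_lt_one hz))
  refine (hQz.comp z hcayley).congr_deriv ?_
  have hsub : 1 - (z - I) / (z + I) = 2 * I / (z + I) := by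
    field_simp
    ring
  have hinv : I * (1 + (z - I) / (z + I)) / (2 * I / (z + I)) = z := by
    field_simp
    ring
  simp only [hsub, hinv]
  field_simp

lemma hasDerivAt_vertical {P : ℂ → ℂ} {x t : ℝ} {p : ℂ} (hP : HasDerivAt P p (x + t * I)) :
    HasDerivAt (fun t : ℝ ↦ P (x + t * I)) (p * I) t := by
  have hline : HasDerivAt (fun t : ℝ ↦ (x : ℂ) + t * I) I t :=
    (((hasDerivAt_id t).ofReal_comp.mul_const I).const_add (x : ℂ)).congr_deriv
      (by rw [Complex.ofReal_one, one_mul])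
  exact hP.comp t hline

lemma tendsto_sub_integral_Ioi {ι : Type*} {l : Filter ι} [l.IsCountablyGenerated]
    {E : Type*} [NormedAddCommGroup E] [NormedSpace ℝ E] [CompleteSpace E] {u u' : ℝ → E} {c : ℝ}
    (hu : ∀ t, c < t → HasDerivAt u (u' t) t) (hint : IntegrableOn u' (Set.Ioi c)) {a b : ι → ℝ}
    (ha : Tendsto a l (𝓝[>] c)) (hb : Tendsto b l atTop) :
    Tendsto (fun i ↦ u (b i) - u (a i)) l (𝓝 (∫ t in Set.Ioi c, u' t)) := by
  rw [tendsto_nhdsWithin_iff] at ha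
  have hcov : AECover (volume.restrict (Set.Ioi c)) l fun i ↦ Set.Ioc (a i) (b i) :=
    (aecover_Ioi_of_Ioi ha.1).inter (aecover_Iic hb).restrict
  refine (hcov.integral_tendsto_of_countably_generated hint).congr' ?_
  filter_upwards [ha.2, ha.1.eventually_lt_const (lt_add_one c), hb.eventually_ge_atTop (c + 1)]
    with i hca ha1 hb1
  have hab : a i ≤ b i := ha1.le.trans hb1
  have hsub : Set.Ioc (a i) (b i) ⊆ Set.Ioi c := fun t ht ↦ lt_trans hca ht.1
  rw [Measure.restrict_restrict measurableSet_Ioc, Set.inter_eq_left.2 hsub,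
    ← intervalIntegral.integral_of_le hab]
  refine intervalIntegral.integral_eq_sub_of_hasDerivAt (fun t ht ↦ hu t ?_) ?_
  · rw [Set.uIcc_of_le hab] at ht
    exact lt_of_lt_of_le hca ht.1
  · rw [intervalIntegrable_iff_integrableOn_Ioc_of_le hab]
    exact hint.mono_set hsub

lemma norm_sub_le_of_horizontal {P Φ : ℂ → ℂ} {p q T B : ℝ}
    (hP : ∀ ξ ∈ Set.uIcc p q, HasDerivAt P (Φ (ξ + T * I)) (ξ + T * I))
    (hB : ∀ ξ ∈ Set.uIcc p q, ‖Φ (ξ + T * I)‖ ≤ B) :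
    ‖P (q + T * I) - P (p + T * I)‖ ≤ B * |q - p| := by
  have hderiv : ∀ ξ ∈ Set.uIcc p q,
      HasDerivWithinAt (fun ξ : ℝ ↦ P (ξ + T * I)) (Φ (ξ + T * I)) (Set.uIcc p q) ξ := by
    intro ξ hξ
    have hline : HasDerivAt (fun ξ : ℝ ↦ (ξ : ℂ) + T * I) 1 ξ :=
      (hasDerivAt_id ξ).ofReal_comp.add_const (T * I)
    exact (((hP ξ hξ).comp ξ hline).congr_deriv (mul_one _)).hasDerivWithinAt
  simpa only [Real.norm_eq_abs] using
    Convex.norm_image_sub_le_of_norm_hasDerivWithin_le hderiv hB (convex_uIcc p q)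
      Set.left_mem_uIcc Set.right_mem_uIcc

/-! ### Primitives of the Eichler kernel -/

lemma moebius_inv (σ : SL(2, ℝ)) (x : ℝ) :
    moebius σ⁻¹ x = (σ 1 1 * x - σ 0 1) / (-σ 1 0 * x + σ 0 0) := by
  simp [moebius, adjugate_fin_two, sub_eq_add_neg]

lemma bottom_row_moebius_inv_mul (σ : SL(2, ℝ)) {x : ℝ} (hx : -σ 1 0 * x + σ 0 0 ≠ 0) :
    (σ 1 0 * moebius σ⁻¹ x + σ 1 1) * (-σ 1 0 * x + σ 0 0) = 1 := by
  have hdet : σ 0 0 * σ 1 1 - σ 0 1 * σ 1 0 = 1 := by rw [← det_fin_two, σ.det_coe]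
  have hy : moebius σ⁻¹ x * (-σ 1 0 * x + σ 0 0) = σ 1 1 * x - σ 0 1 := by
    rw [moebius_inv, div_mul_cancel₀ _ hx]
  linear_combination σ 1 0 * hy + hdet

lemma moebius_moebius_inv (σ : SL(2, ℝ)) {x : ℝ} (hx : -σ 1 0 * x + σ 0 0 ≠ 0) :
    moebius σ (moebius σ⁻¹ x) = x := by
  have hy : moebius σ⁻¹ x * (-σ 1 0 * x + σ 0 0) = σ 1 1 * x - σ 0 1 := by
    rw [moebius_inv, div_mul_cancel₀ _ hx]
  rw [moebius, div_eq_iff (left_ne_zero_of_mul_eq_one (bottom_row_moebius_inv_mul σ hx))]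
  linear_combination hy

lemma coe_smul_sub_moebius (σ : SL(2, ℝ)) {y : ℝ} (hy : σ 1 0 * y + σ 1 1 ≠ 0) (w : ℍ) :
    ((σ • w : ℍ) : ℂ) - moebius σ y = (w - y) / (autFactor σ w * (σ 1 0 * y + σ 1 1 : ℝ)) := by
  have hdet : (σ 0 0 : ℂ) * σ 1 1 - σ 0 1 * σ 1 0 = 1 := by
    exact_mod_cast (det_fin_two (σ : Matrix (Fin 2) (Fin 2) ℝ)).symm.trans σ.det_coe
  have hw := autFactor_ne_zero σ w
  have hy' : (σ 1 0 * y + σ 1 1 : ℂ) ≠ 0 := by exact_mod_cast hy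
  rw [coe_smul_eq_div_autFactor, moebius]
  push_cast
  rw [div_sub_div _ _ hw hy', autFactor]
  congr 1
  linear_combination (w - y) * hdet

lemma tendsto_autFactor_vertical (σ : SL(2, ℝ)) (y : ℝ) :
    Tendsto (fun s : ℝ ↦ autFactor σ (ofComplex (y + s * I))) (𝓝[>] 0)
      (𝓝 ((σ 1 0 * y + σ 1 1 : ℝ) : ℂ)) := by
  have hcont : Continuous fun s : ℝ ↦ (σ 1 0 : ℂ) * (y + s * I) + σ 1 1 := by fun_prop
  have hlim := (hcont.tendsto 0).mono_left (nhdsWithin_le_nhds (s := Set.Ioi 0))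
  push_cast
  rw [Complex.ofReal_zero, zero_mul, add_zero] at hlim
  refine hlim.congr' ?_
  filter_upwards [self_mem_nhdsWithin] with s hs
  rw [autFactor, coe_ofComplex_add_mul_I hs]

lemma tendsto_im_smul_vertical {σ : SL(2, ℝ)} {y : ℝ} (hy : σ 1 0 * y + σ 1 1 ≠ 0) :
    Tendsto (fun s : ℝ ↦ (σ • ofComplex (y + s * I)).im) (𝓝[>] 0) (𝓝 0) := by
  have hj := ((tendsto_autFactor_vertical σ y).norm.pow 2)
  have hlim := (tendsto_nhdsWithin_of_tendsto_nhds tendsto_id).div hj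
    (pow_ne_zero 2 (norm_ne_zero_iff.2 (Complex.ofReal_ne_zero.2 hy)))
  rw [zero_div] at hlim
  refine hlim.congr' ?_
  filter_upwards [self_mem_nhdsWithin] with s hs
  rw [im_smul_eq_div_norm_autFactor_sq, im_ofComplex_add_mul_I hs]
  rfl

lemma eventually_abs_re_smul_sub_moebius_le {σ : SL(2, ℝ)} {y : ℝ} (hy : σ 1 0 * y + σ 1 1 ≠ 0) :
    ∀ᶠ s : ℝ in 𝓝[>] 0, |(σ • ofComplex (y + s * I)).re - moebius σ y| ≤
      2 * (σ • ofComplex (y + s * I)).im := by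
  set ρ : ℝ := σ 1 0 * y + σ 1 1
  have hρ : 0 < |ρ| := abs_pos.2 hy
  have hj : ∀ᶠ s : ℝ in 𝓝[>] 0, ‖autFactor σ (ofComplex (y + s * I))‖ < 2 * |ρ| := by
    refine (tendsto_autFactor_vertical σ y).norm.eventually_lt_const ?_
    rw [Complex.norm_real, Real.norm_eq_abs]
    linarith
  filter_upwards [self_mem_nhdsWithin, hj] with s hs hjs
  set w := ofComplex (y + s * I) with hw
  have hjw : 0 < ‖autFactor σ w‖ := norm_pos_iff.2 (autFactor_ne_zero σ w)
  have hs' : 0 < s := hs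
  calc |(σ • w).re - moebius σ y|
      = |(((σ • w : ℍ) : ℂ) - moebius σ y).re| := by rw [Complex.sub_re, Complex.ofReal_re, coe_re]
    _ ≤ ‖((σ • w : ℍ) : ℂ) - moebius σ y‖ := Complex.abs_re_le_norm _
    _ = s / (‖autFactor σ w‖ * |ρ|) := by
      rw [coe_smul_sub_moebius σ hy, hw, coe_ofComplex_add_mul_I hs, add_sub_cancel_left, norm_div,
        norm_mul, norm_mul, Complex.norm_I, mul_one, Complex.norm_real, Complex.norm_real,
        Real.norm_of_nonneg hs'.le, Real.norm_eq_abs]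
    _ ≤ 2 * (s / ‖autFactor σ w‖ ^ 2) := by
      rw [← mul_div_assoc, div_le_div_iff₀ (by positivity) (by positivity)]
      have := mul_le_mul_of_nonneg_left hjs.le (mul_pos hs' hjw).le
      linarith
    _ = 2 * (σ • w).im := by
      rw [im_smul_eq_div_norm_autFactor_sq, hw, im_ofComplex_add_mul_I hs]

lemma autFactor_vertical_pole {σ : SL(2, ℝ)} (hσ : σ 1 0 ≠ 0) {t : ℝ} (ht : 0 < t) :
    autFactor σ (ofComplex ((-σ 1 1 / σ 1 0 : ℝ) + t * I)) = σ 1 0 * t * I := by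
  have hσ' : (σ 1 0 : ℂ) ≠ 0 := Complex.ofReal_ne_zero.2 hσ
  rw [autFactor, coe_ofComplex_add_mul_I ht]
  push_cast
  field_simp
  ring

lemma coe_smul_vertical_pole {σ : SL(2, ℝ)} (hσ : σ 1 0 ≠ 0) {t : ℝ} (ht : 0 < t) :
    ((σ • ofComplex ((-σ 1 1 / σ 1 0 : ℝ) + t * I) : ℍ) : ℂ) =
      (σ 0 0 / σ 1 0 : ℝ) + ((σ 1 0 ^ 2 * t)⁻¹ : ℝ) * I := by
  have hdet : (σ 0 0 : ℂ) * σ 1 1 - σ 0 1 * σ 1 0 = 1 := by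
    exact_mod_cast (det_fin_two (σ : Matrix (Fin 2) (Fin 2) ℝ)).symm.trans σ.det_coe
  have hσ' : (σ 1 0 : ℂ) ≠ 0 := Complex.ofReal_ne_zero.2 hσ
  have ht' : (t : ℂ) ≠ 0 := Complex.ofReal_ne_zero.2 ht.ne'
  rw [coe_smul_eq_div_autFactor, autFactor_vertical_pole hσ ht, coe_ofComplex_add_mul_I ht]
  push_cast
  field_simp
  linear_combination -hdet - Complex.I_sq

lemma hasDerivAt_coe_smul_ofComplex (σ : SL(2, ℝ)) {w : ℂ} (hw : 0 < w.im) :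
    HasDerivAt (fun w : ℂ ↦ ((σ • ofComplex w : ℍ) : ℂ)) (1 / autFactor σ (ofComplex w) ^ 2) w := by
  have hderiv := (hasStrictDerivAt_smul (g := SpecialLinearGroup.mapGL ℝ σ) (by simp)
    (ofComplex w)).hasDerivAt
  have hdet : (SpecialLinearGroup.mapGL ℝ σ).val.det = 1 := by simp
  have hw' : ((ofComplex w : ℍ) : ℂ) = w := by rw [ofComplex_apply_of_im_pos hw]
  rw [hdet, Complex.ofReal_one, ← autFactor_eq_denom, hw'] at hderiv
  exact hderiv

/-- The integrand `(z - x) ^ (r - 2) g(z)` of the Eichler integral as a function on the plane;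
`eichlerIntegrand r g x₀ x` is its pullback to the vertical ray over `x₀`. -/
def eichlerDensity (r : ℝ) (g : ℍ → ℂ) (x : ℝ) (z : ℂ) : ℂ :=
  (z - x) ^ ((r - 2 : ℝ) : ℂ) * g (ofComplex z)

/-- The constant relating the kernels `(z - x) ^ (r - 2)` and `(w - σ⁻¹x) ^ (r - 2)`, `z = σw`,
where `c` is the lower left entry of `σ` and `u = x - σ∞`. -/
def kernelFactor (r c u : ℝ) : ℂ :=
  ((|c| ^ (r - 2) : ℝ) : ℂ) * (((|u| ^ (2 * (r - 1)) : ℝ) : ℂ) * (u : ℂ) ^ (-r : ℂ))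

section Density

variable {r : ℝ} {g : ℍ → ℂ} {x : ℝ}

lemma differentiableOn_eichlerDensity (hg : MDiff g) :
    DifferentiableOn ℂ (eichlerDensity r g x) {z | 0 < z.im} := by
  refine DifferentiableOn.mul ?_ (UpperHalfPlane.mdifferentiable_iff.1 hg)
  refine (differentiableOn_id.sub_const _).cpow_const fun z hz ↦ Or.inr ?_
  simpa using ne_of_gt hz

lemma norm_eichlerDensity_le (hr : 2 ≤ r) {ξ T L : ℝ} (hT : 0 < T) (hξ : |ξ - x| ≤ L * T) :
    ‖eichlerDensity r g x (ξ + T * I)‖ ≤ ((L + 1) * T) ^ (r - 2) * ‖g (ofComplex (ξ + T * I))‖ := by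
  have hnorm : ‖(ξ + T * I - x : ℂ)‖ ≤ (L + 1) * T := by
    calc ‖(ξ + T * I - x : ℂ)‖ = ‖((ξ - x : ℝ) : ℂ) + T * I‖ := by
          push_cast
          ring_nf
      _ ≤ ‖((ξ - x : ℝ) : ℂ)‖ + ‖T * I‖ := norm_add_le _ _
      _ = |ξ - x| + T := by
          rw [Complex.norm_real, norm_mul, Complex.norm_I, mul_one, Complex.norm_real,
            Real.norm_eq_abs, Real.norm_of_nonneg hT.le]
      _ ≤ (L + 1) * T := by linarith
  rw [eichlerDensity, norm_mul, Complex.norm_cpow_real]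
  exact mul_le_mul_of_nonneg_right
    (Real.rpow_le_rpow (norm_nonneg _) hnorm (by linarith)) (norm_nonneg _)

end Density

lemma kernelFactor_eq {c u : ℝ} (hc : c < 0) (hu : u ≠ 0) (r : ℝ) :
    kernelFactor r c u = ((|-c * u| : ℝ) : ℂ) ^ (2 * ((r - 2 : ℝ) : ℂ)) *
      ((-c * u : ℝ) : ℂ) ^ (-((r - 2 : ℝ) : ℂ)) := by
  have hc' : 0 < -c := neg_pos.2 hc
  have hu' : (u : ℂ) ≠ 0 := Complex.ofReal_ne_zero.2 hu
  have habs : |u| ^ (2 * (r - 1)) = |u| ^ (2 * (r - 2)) * u ^ 2 := by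
    rw [← sq_abs u, ← Real.rpow_two, ← Real.rpow_add (abs_pos.2 hu)]
    ring_nf
  have hpow : (u : ℂ) ^ (-((r - 2 : ℝ) : ℂ)) = u ^ 2 * (u : ℂ) ^ (-r : ℂ) := by
    rw [← Complex.cpow_two, ← Complex.cpow_add _ _ hu']
    push_cast
    ring_nf
  have hcpow : (-c) ^ (2 * (r - 2)) * (-c) ^ (-(r - 2)) = (-c) ^ (r - 2) := by
    rw [← Real.rpow_add hc']
    ring_nf
  have hexp : 2 * ((r - 2 : ℝ) : ℂ) = ((2 * (r - 2) : ℝ) : ℂ) := by push_cast; rfl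
  rw [Complex.ofReal_mul (-c) u, ofReal_mul_cpow hc' hu', hpow, hexp, abs_mul, abs_of_pos hc',
    ← Complex.ofReal_cpow (by positivity), Real.mul_rpow hc'.le (abs_nonneg u),
    ← Complex.ofReal_neg, ← Complex.ofReal_cpow hc'.le, kernelFactor, habs, abs_of_neg hc, ← hcpow]
  push_cast
  ring

lemma sub_cpow_mul_autFactor_cpow {σ : SL(2, ℝ)} (hσ : σ 1 0 < 0) {x x₀ : ℝ}
    (hx₀ : x₀ * σ 1 0 = σ 0 0) (hx : x ≠ x₀) (r : ℝ) (w : ℍ) :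
    (((σ • w : ℍ) : ℂ) - x) ^ ((r - 2 : ℝ) : ℂ) * autFactor σ w ^ ((r - 2 : ℝ) : ℂ) =
      kernelFactor r (σ 1 0) (x - x₀) * ((w : ℂ) - moebius σ⁻¹ x) ^ ((r - 2 : ℝ) : ℂ) := by
  have hq : -σ 1 0 * x + σ 0 0 = -σ 1 0 * (x - x₀) := by linear_combination -hx₀
  have hq0 : -σ 1 0 * x + σ 0 0 ≠ 0 := by
    rw [hq]
    exact mul_ne_zero (neg_ne_zero.2 hσ.ne) (sub_ne_zero.2 hx)
  have hbase : (((σ • w : ℍ) : ℂ) - x) * autFactor σ w =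
      ((-σ 1 0 * (x - x₀) : ℝ) : ℂ) * (w - moebius σ⁻¹ x) := by
    have hρ := bottom_row_moebius_inv_mul σ hq0
    have hsub := coe_smul_sub_moebius σ (left_ne_zero_of_mul_eq_one hρ) w
    rw [moebius_moebius_inv σ hq0] at hsub
    rw [hsub, ← hq, eq_inv_of_mul_eq_one_left hρ, Complex.ofReal_inv]
    have := autFactor_ne_zero σ w
    field_simp
  rw [← mul_cpow_of_im_pos_of_im_neg, hbase,
    ofReal_mul_cpow_of_im_pos (hq ▸ hq0), kernelFactor_eq hσ (sub_ne_zero.2 hx)]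
  · simpa using w.im_pos
  · simpa using (σ • w).im_pos
  · rw [im_autFactor]
    exact mul_neg_of_neg_of_pos hσ w.im_pos

/-- `P` is a primitive of `k (z - x) ^ (r - 2) g(z)` on the upper half-plane. -/
def IsEichlerPrimitive (r : ℝ) (g : ℍ → ℂ) (x : ℝ) (k : ℂ) (P : ℂ → ℂ) : Prop :=
  ∀ z : ℂ, 0 < z.im → HasDerivAt P (k * eichlerDensity r g x z) z

lemma exists_isEichlerPrimitive (r : ℝ) {g : ℍ → ℂ} (hg : MDiff g) (x : ℝ) :
    ∃ P, IsEichlerPrimitive r g x 1 P := by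
  simpa only [IsEichlerPrimitive, one_mul] using
    exists_hasDerivAt_of_differentiableOn_im_pos (differentiableOn_eichlerDensity hg)

namespace IsEichlerPrimitive

variable {r x : ℝ} {g : ℍ → ℂ} {k : ℂ} {P : ℂ → ℂ}

lemma comp_smul (hP : IsEichlerPrimitive r g x k P) {σ : SL(2, ℝ)} (hσ : σ 1 0 < 0) {x₀ : ℝ}
    (hx₀ : x₀ * σ 1 0 = σ 0 0) (hx : x ≠ x₀) :
    IsEichlerPrimitive r (slash r σ g) (moebius σ⁻¹ x) (k * kernelFactor r (σ 1 0) (x - x₀))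
      fun w ↦ P (σ • ofComplex w : ℍ) := by
  intro w hw
  refine ((hP _ (σ • ofComplex w).im_pos).comp w
    (hasDerivAt_coe_smul_ofComplex σ hw)).congr_deriv ?_
  have hj := autFactor_ne_zero σ (ofComplex w)
  have hjr := autFactor_cpow_ne_zero σ (ofComplex w) r
  have hkernel := sub_cpow_mul_autFactor_cpow hσ hx₀ hx r (ofComplex w)
  have hjpow : 1 / autFactor σ (ofComplex w) ^ 2 =
      autFactor σ (ofComplex w) ^ ((r - 2 : ℝ) : ℂ) / autFactor σ (ofComplex w) ^ (r : ℂ) := by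
    rw [Complex.ofReal_sub, Complex.cpow_sub _ _ hj, Complex.ofReal_ofNat, Complex.cpow_ofNat]
    field_simp
  have hwc : ((ofComplex w : ℍ) : ℂ) = w := by rw [ofComplex_apply_of_im_pos hw]
  rw [hwc] at hkernel
  rw [eichlerDensity, eichlerDensity, ofComplex_apply, slash, hjpow]
  linear_combination
    k * g (σ • ofComplex w) / autFactor σ (ofComplex w) ^ (r : ℂ) * hkernel

lemma norm_horizontal_sub_le (hP : IsEichlerPrimitive r g x k P) (hr : 2 ≤ r) {p q T L M : ℝ}
    (hT : 0 < T) (hp : |p - x| ≤ L * T) (hq : |q - x| ≤ L * T)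
    (hM : ∀ ξ : ℝ, ‖g (ofComplex (ξ + T * I))‖ ≤ M) :
    ‖P (q + T * I) - P (p + T * I)‖ ≤ ‖k‖ * (((L + 1) * T) ^ (r - 2) * M) * |q - p| := by
  refine norm_sub_le_of_horizontal (Φ := fun z ↦ k * eichlerDensity r g x z)
    (fun ξ _ ↦ hP (ξ + T * I) (by simpa using hT)) fun ξ hξ ↦ ?_
  have hξx : |ξ - x| ≤ L * T := by
    have hmem := (convex_closedBall x (L * T)).ordConnected.uIcc_subset
      (Metric.mem_closedBall.2 hp) (Metric.mem_closedBall.2 hq) hξ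
    exact Metric.mem_closedBall.1 hmem
  have hbase : 0 ≤ (L + 1) * T := by linarith [abs_nonneg (ξ - x)]
  rw [norm_mul]
  refine mul_le_mul_of_nonneg_left ((norm_eichlerDensity_le hr hT hξx).trans ?_) (norm_nonneg k)
  exact mul_le_mul_of_nonneg_left (hM ξ) (Real.rpow_nonneg hbase _)

lemma tendsto_horizontal_sub (hP : IsEichlerPrimitive r g x k P) (hr : 2 ≤ r)
    (hg : g =O[atImInfty] fun z ↦ z.im ^ (-r)) (p q : ℝ) :
    Tendsto (fun T : ℝ ↦ P (q + T * I) - P (p + T * I)) atTop (𝓝 0) := by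
  obtain ⟨M, hM⟩ := hg.bound
  obtain ⟨Y, hY⟩ := (atImInfty_mem _).1 hM
  have hlim : Tendsto (fun T : ℝ ↦ ‖k‖ * (2 ^ (r - 2) * M) * |q - p| * T ^ (-2 : ℝ)) atTop
      (𝓝 0) := by
    simpa only [mul_zero] using (tendsto_rpow_neg_atTop two_pos).const_mul _
  refine squeeze_zero_norm' ?_ hlim
  filter_upwards [eventually_gt_atTop 0, eventually_ge_atTop Y, eventually_ge_atTop |p - x|,
    eventually_ge_atTop |q - x|] with T hT hTY hp hq
  have hgT (ξ : ℝ) : ‖g (ofComplex (ξ + T * I))‖ ≤ M * T ^ (-r) := by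
    have hbound := hY (ofComplex (ξ + T * I)) (by rwa [im_ofComplex_add_mul_I hT])
    rwa [Set.mem_ofPred_eq, im_ofComplex_add_mul_I hT, Real.norm_of_nonneg (by positivity)]
      at hbound
  refine (hP.norm_horizontal_sub_le hr (L := 1) hT (by rwa [one_mul]) (by rwa [one_mul])
    hgT).trans_eq ?_
  have hpow : T ^ (-2 : ℝ) = T ^ (r - 2) * T ^ (-r) := by
    rw [← Real.rpow_add hT]
    ring_nf
  rw [hpow, one_add_one_eq_two, Real.mul_rpow zero_le_two hT.le]
  ring

lemma tendsto_sub_vertical (hP : IsEichlerPrimitive r g x k P) (hr : 2 < r) {C : ℝ}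
    (hC : ∀ z : ℍ, ‖g z‖ ≤ C * z.im ^ (-(r / 2))) {ι : Type*} {l : Filter ι} {z : ι → ℍ}
    (hz : Tendsto (fun i ↦ (z i).im) l (𝓝 0)) {L : ℝ}
    (hL : ∀ᶠ i in l, |(z i).re - x| ≤ L * (z i).im) :
    Tendsto (fun i ↦ P (z i) - P (x + (z i).im * I)) l (𝓝 0) := by
  have hlim : Tendsto (fun i ↦ ‖k‖ * ((L + 1) ^ (r - 2) * C) * L * (z i).im ^ (r / 2 - 1)) l
      (𝓝 0) := by
    have hpow := hz.rpow_const (p := r / 2 - 1) (Or.inr (by linarith))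
    rw [Real.zero_rpow (by linarith)] at hpow
    simpa only [mul_zero] using hpow.const_mul _
  refine squeeze_zero_norm' ?_ hlim
  filter_upwards [hL] with i hi
  set T := (z i).im
  have hT0 : 0 < T := (z i).im_pos
  have hL0 : 0 ≤ L := nonneg_of_mul_nonneg_left ((abs_nonneg _).trans hi) hT0
  have hC0 : 0 ≤ C := nonneg_of_mul_nonneg_left ((norm_nonneg _).trans (hC (z i)))
    (Real.rpow_pos_of_pos (z i).im_pos _)
  have hgT (ξ : ℝ) : ‖g (ofComplex (ξ + T * I))‖ ≤ C * T ^ (-(r / 2)) := by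
    simpa only [im_ofComplex_add_mul_I hT0] using hC (ofComplex (ξ + T * I))
  have hzi : (z i : ℂ) = (z i).re + T * I := (Complex.re_add_im _).symm
  calc ‖P (z i) - P (x + T * I)‖
      ≤ ‖k‖ * (((L + 1) * T) ^ (r - 2) * (C * T ^ (-(r / 2)))) * |(z i).re - x| := by
        rw [hzi]
        exact hP.norm_horizontal_sub_le hr.le hT0 (by simpa using mul_nonneg hL0 hT0.le) hi hgT
    _ ≤ ‖k‖ * (((L + 1) * T) ^ (r - 2) * (C * T ^ (-(r / 2)))) * (L * T) := by gcongr
    _ = ‖k‖ * ((L + 1) ^ (r - 2) * C) * L * (T ^ (r - 2) * T ^ (-(r / 2)) * T) := by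
        rw [Real.mul_rpow (by positivity) hT0.le]
        ring
    _ = ‖k‖ * ((L + 1) ^ (r - 2) * C) * L * T ^ (r / 2 - 1) := by
        rw [← Real.rpow_add hT0, ← Real.rpow_add_one hT0.ne']
        ring_nf

lemma tendsto_vertical_sub (hP : IsEichlerPrimitive r g x k P) {ξ : ℝ}
    (hint : IntegrableOn (eichlerIntegrand r g ξ x) (Set.Ioi 0)) {ι : Type*} {l : Filter ι}
    [l.IsCountablyGenerated] {a b : ι → ℝ} (ha : Tendsto a l (𝓝[>] 0)) (hb : Tendsto b l atTop) :
    Tendsto (fun i ↦ P (ξ + b i * I) - P (ξ + a i * I)) l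
      (𝓝 (k * ∫ t in Set.Ioi 0, eichlerIntegrand r g ξ x t)) := by
  have hderiv (t : ℝ) (ht : 0 < t) :
      HasDerivAt (fun t : ℝ ↦ P (ξ + t * I)) (k * eichlerIntegrand r g ξ x t) t :=
    (hasDerivAt_vertical (hP _ (by simpa using ht))).congr_deriv (mul_assoc _ _ _)
  rw [← integral_const_mul]
  exact tendsto_sub_integral_Ioi hderiv (hint.const_mul k) ha hb

end IsEichlerPrimitive

/-! ### The Eichler integral -/

lemma isBigO_one_vertical_of_isBigO_slash {r : ℝ} {f : ℍ → ℂ} {σ : SL(2, ℝ)} (hσ : σ 1 0 ≠ 0)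
    (hf : slash r σ f =O[atImInfty] fun z ↦ z.im ^ (-r)) :
    (fun t : ℝ ↦ f (ofComplex ((σ 0 0 / σ 1 0 : ℝ) + t * I))) =O[𝓝[>] 0] fun _ ↦ (1 : ℝ) := by
  obtain ⟨C, hC⟩ := hf.bound
  obtain ⟨Y, hY⟩ := (atImInfty_mem _).1 hC
  have hc : 0 < σ 1 0 ^ 2 := by positivity
  have hs : Tendsto (fun t : ℝ ↦ (σ 1 0 ^ 2)⁻¹ * t⁻¹) (𝓝[>] 0) atTop :=
    tendsto_inv_nhdsGT_zero.const_mul_atTop (inv_pos.2 hc)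
  refine IsBigO.of_bound (C * |σ 1 0| ^ r) ?_
  filter_upwards [self_mem_nhdsWithin, hs.eventually_ge_atTop Y] with t ht hYt
  have ht0 : 0 < t := ht
  set s : ℝ := (σ 1 0 ^ 2)⁻¹ * t⁻¹ with hs_def
  have hs0 : 0 < s := by positivity
  have hst : (σ 1 0 ^ 2 * s)⁻¹ = t := by
    rw [hs_def, mul_inv_cancel_left₀ hc.ne', inv_inv]
  set w := ofComplex ((-σ 1 1 / σ 1 0 : ℝ) + s * I)
  have hw : w.im = s := im_ofComplex_add_mul_I hs0
  have hσw : ofComplex ((σ 0 0 / σ 1 0 : ℝ) + t * I) = σ • w := by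
    rw [← hst, ← coe_smul_vertical_pole hσ hs0, ofComplex_apply]
  have hj : ‖autFactor σ w‖ = |σ 1 0| * s := by
    rw [autFactor_vertical_pole hσ hs0, norm_mul, norm_mul, Complex.norm_I, mul_one,
      Complex.norm_real, Complex.norm_real, Real.norm_eq_abs, Real.norm_of_nonneg hs0.le]
  have hbound : ‖slash r σ f w‖ ≤ C * s ^ (-r) := by
    simpa only [Set.mem_ofPred_eq, hw, Real.norm_of_nonneg (Real.rpow_nonneg hs0.le _)]
      using hY w (hw ▸ hYt)
  rw [norm_slash, hj, div_le_iff₀ (by positivity), Real.mul_rpow (abs_nonneg _) hs0.le] at hbound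
  rw [hσw, norm_one, mul_one]
  refine hbound.trans_eq ?_
  rw [Real.rpow_neg hs0.le]
  field_simp

section Decay

variable {r : ℝ} {f : ℍ → ℂ} {x₀ : ℝ}

lemma isBigO_eichlerIntegrand_atTop (hr : 2 ≤ r) (hf : f =O[atImInfty] fun z ↦ z.im ^ (-r))
    (x : ℝ) : eichlerIntegrand r f x₀ x =O[atTop] fun t ↦ t ^ (-2 : ℝ) := by
  obtain ⟨M, hM⟩ := hf.bound
  obtain ⟨Y, hY⟩ := (atImInfty_mem _).1 hM
  refine IsBigO.of_bound (2 ^ (r - 2) * M) ?_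
  filter_upwards [eventually_gt_atTop 0, eventually_ge_atTop Y, eventually_ge_atTop |x₀ - x|]
    with t ht hYt hxt
  have hft : ‖f (ofComplex (x₀ + t * I))‖ ≤ M * t ^ (-r) := by
    have hbound := hY (ofComplex (x₀ + t * I)) (by rwa [im_ofComplex_add_mul_I ht])
    rwa [Set.mem_ofPred_eq, im_ofComplex_add_mul_I ht, Real.norm_of_nonneg (by positivity)]
      at hbound
  calc ‖eichlerIntegrand r f x₀ x t‖ = ‖eichlerDensity r f x (x₀ + t * I)‖ := by
        rw [eichlerIntegrand, norm_mul, Complex.norm_I, mul_one, eichlerDensity]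
    _ ≤ ((1 + 1) * t) ^ (r - 2) * (M * t ^ (-r)) :=
        (norm_eichlerDensity_le hr ht (by rwa [one_mul])).trans (by gcongr)
    _ = 2 ^ (r - 2) * M * ‖t ^ (-2 : ℝ)‖ := by
        rw [Real.norm_of_nonneg (by positivity), Real.mul_rpow (by norm_num) ht.le,
          show (-2 : ℝ) = r - 2 + -r by ring, Real.rpow_add ht, one_add_one_eq_two]
        ring

lemma isBigO_eichlerIntegrand_nhdsGT_zero (hr : 2 ≤ r)
    (hf : (fun t : ℝ ↦ f (ofComplex (x₀ + t * I))) =O[𝓝[>] 0] fun _ ↦ (1 : ℝ)) (x : ℝ) :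
    eichlerIntegrand r f x₀ x =O[𝓝[>] 0] fun _ ↦ (1 : ℝ) := by
  have hkernel : (fun t : ℝ ↦ ((x₀ + t * I) - x : ℂ) ^ ((r - 2 : ℝ) : ℂ)) =O[𝓝[>] 0]
      fun _ ↦ (1 : ℝ) := by
    have hnorm : Continuous fun t : ℝ ↦ ‖((x₀ + t * I) - x : ℂ)‖ ^ (r - 2) :=
      (by fun_prop : Continuous fun t : ℝ ↦ ‖((x₀ + t * I) - x : ℂ)‖).rpow_const
        fun _ ↦ Or.inr (by linarith)
    refine .of_norm_left (((hnorm.tendsto 0).mono_left nhdsWithin_le_nhds).isBigO_one ℝ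
      |>.congr_left fun t ↦ ?_)
    rw [Complex.norm_cpow_real]
  refine ((hkernel.mul hf).mul (isBigO_const_const I (one_ne_zero (α := ℝ)) _)).congr_right
    fun _ ↦ ?_
  rw [mul_one, mul_one]

lemma integrableOn_eichlerIntegrand (hr : 2 ≤ r) (hf : MDiff f)
    (htop : f =O[atImInfty] fun z ↦ z.im ^ (-r))
    (hbot : (fun t : ℝ ↦ f (ofComplex (x₀ + t * I))) =O[𝓝[>] 0] fun _ ↦ (1 : ℝ)) (x : ℝ) :
    IntegrableOn (eichlerIntegrand r f x₀ x) (Set.Ioi 0) := by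
  have hcont : ContinuousOn (eichlerIntegrand r f x₀ x) (Set.Ioi 0) := by
    refine ((differentiableOn_eichlerDensity hf).continuousOn.comp (f := fun t : ℝ ↦ x₀ + t * I)
      (by fun_prop) fun t ht ↦ ?_).mul continuousOn_const
    simpa using ht
  have hmellin : MellinConvergent (eichlerIntegrand r f x₀ x) 1 :=
    mellinConvergent_of_isBigO_rpow (a := 2) (b := 0) (hcont.locallyIntegrableOn measurableSet_Ioi)
      (isBigO_eichlerIntegrand_atTop hr htop x) (by norm_num)
      (by simpa using isBigO_eichlerIntegrand_nhdsGT_zero hr hbot x) (by norm_num)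
  simpa [MellinConvergent] using hmellin

end Decay

section Mellin

variable {r : ℝ} {g : ℍ → ℂ} {y : ℝ}

lemma eichlerIntegrand_self (r : ℝ) (g : ℍ → ℂ) (y : ℝ) {t : ℝ} (ht : 0 < t) :
    eichlerIntegrand r g y y t = I ^ ((r - 1 : ℝ) : ℂ) *
      ((t : ℂ) ^ (((r - 1 : ℝ) : ℂ) - 1) • g (ofComplex (y + t * I))) := by
  have hexp : ((r - 2 : ℝ) : ℂ) = ((r - 1 : ℝ) : ℂ) - 1 := by
    push_cast
    ring
  have hI : I ^ (((r - 1 : ℝ) : ℂ) - 1) * I = I ^ ((r - 1 : ℝ) : ℂ) := by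
    rw [Complex.cpow_sub _ _ Complex.I_ne_zero, Complex.cpow_one,
      div_mul_cancel₀ _ Complex.I_ne_zero]
  rw [eichlerIntegrand, add_sub_cancel_left, ofReal_mul_cpow ht Complex.I_ne_zero, hexp, ← hI,
    smul_eq_mul]
  ring

lemma integrableOn_eichlerIntegrand_self
    (hg : MellinConvergent (fun t ↦ g (ofComplex (y + t * I))) ((r - 1 : ℝ) : ℂ)) :
    IntegrableOn (eichlerIntegrand r g y y) (Set.Ioi 0) :=
  IntegrableOn.congr_fun (hg.const_mul (I ^ ((r - 1 : ℝ) : ℂ)))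
    (fun _ ht ↦ (eichlerIntegrand_self r g y ht).symm) measurableSet_Ioi

lemma integral_eichlerIntegrand_self (r : ℝ) (g : ℍ → ℂ) (y : ℝ) :
    ∫ t in Set.Ioi 0, eichlerIntegrand r g y y t =
      I ^ ((r - 1 : ℝ) : ℂ) * verticalMellin (r - 1) g y := by
  rw [verticalMellin, mellin, ← integral_const_mul]
  exact setIntegral_congr_fun measurableSet_Ioi fun _ ht ↦ eichlerIntegrand_self r g y ht

end Mellin

/- Cauchy's theorem for the contour from `x₀` up to `i∞`, down to `x`, and back to `x₀` along the
image under `σ` of the vertical ray over `σ⁻¹x`. -/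
lemma integral_eichlerIntegrand_eq_sub {r : ℝ} (hr : 2 < r) {f : ℍ → ℂ} (hf : MDiff f) {C : ℝ}
    (hC : ∀ z : ℍ, ‖f z‖ ≤ C * z.im ^ (-(r / 2)))
    (htop : f =O[atImInfty] fun z ↦ z.im ^ (-r)) {σ : SL(2, ℝ)} (hσ : σ 1 0 < 0)
    (hcusp : slash r σ f =O[atImInfty] fun z ↦ z.im ^ (-r)) {x₀ x : ℝ}
    (hx₀ : x₀ * σ 1 0 = σ 0 0) (hx : x ≠ x₀)
    (hint : IntegrableOn (eichlerIntegrand r f x x) (Set.Ioi 0))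
    (hint' : IntegrableOn (eichlerIntegrand r (slash r σ f) (moebius σ⁻¹ x) (moebius σ⁻¹ x))
      (Set.Ioi 0)) :
    ∫ t in Set.Ioi 0, eichlerIntegrand r f x₀ x t =
      (∫ t in Set.Ioi 0, eichlerIntegrand r f x x t) - kernelFactor r (σ 1 0) (x - x₀) *
        ∫ t in Set.Ioi 0, eichlerIntegrand r (slash r σ f) (moebius σ⁻¹ x) (moebius σ⁻¹ x) t := by
  have hq : -σ 1 0 * x + σ 0 0 ≠ 0 := by
    rw [← hx₀, show -σ 1 0 * x + x₀ * σ 1 0 = σ 1 0 * (x₀ - x) by ring]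
    exact mul_ne_zero hσ.ne (sub_ne_zero.2 hx.symm)
  have hρ := left_ne_zero_of_mul_eq_one (bottom_row_moebius_inv_mul σ hq)
  have hx₀' : x₀ = σ 0 0 / σ 1 0 := by rw [eq_div_iff hσ.ne, hx₀]
  obtain ⟨P, hP⟩ := exists_isEichlerPrimitive r hf x
  have hQ := hP.comp_smul hσ hx₀ hx
  have hinv : Tendsto (fun T : ℝ ↦ T⁻¹) atTop (𝓝[>] 0) := tendsto_inv_atTop_nhdsGT_zero
  have him := (tendsto_im_smul_vertical hρ).comp hinv
  have hscaled : Tendsto (fun T : ℝ ↦ (σ 1 0 ^ 2 * T)⁻¹) atTop (𝓝[>] 0) :=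
    hinv.comp (tendsto_id.const_mul_atTop (sq_pos_of_neg hσ))
  have lim_x₀ := hP.tendsto_vertical_sub (ξ := x₀) (integrableOn_eichlerIntegrand hr.le hf htop
    (hx₀' ▸ isBigO_one_vertical_of_isBigO_slash hσ.ne hcusp) x) hscaled tendsto_id
  have lim_x := hP.tendsto_vertical_sub hint
    (tendsto_nhdsWithin_iff.2 ⟨him, .of_forall fun _ ↦ im_pos _⟩) tendsto_id
  have lim_y := hQ.tendsto_vertical_sub hint' hinv tendsto_id
  have top_left := hP.tendsto_horizontal_sub hr.le htop x x₀
  have top_right := hQ.tendsto_horizontal_sub hr.le hcusp (-σ 1 1 / σ 1 0) (moebius σ⁻¹ x)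
  have near_x := hP.tendsto_sub_vertical hr hC him
    (moebius_moebius_inv σ hq ▸ hinv.eventually (eventually_abs_re_smul_sub_moebius_le hρ))
  have hlim := tendsto_nhds_unique ((lim_x₀.sub lim_x).add lim_y)
    (((top_left.sub near_x).add top_right).congr' ?_)
  · linear_combination hlim
  · filter_upwards [eventually_gt_atTop 0] with T hT
    rw [coe_smul_vertical_pole hσ.ne hT, ← hx₀']
    simp only [Function.comp_apply, id_eq]
    ring

/-! ### The approximate functional equation -/

section FracPartialSum

variable {m : ℕ} [NeZero m] {g : ℍ → ℂ} {β C α : ℝ}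

lemma dilate_one (g : ℍ → ℂ) : dilate 1 g = g := by
  ext z
  rw [dilate, Nat.cast_one, one_mul, ofComplex_apply]

lemma dilate_vertical (m : ℕ) [NeZero m] (g : ℍ → ℂ) (x : ℝ) {t : ℝ} (ht : 0 < t) :
    dilate m g (ofComplex ((x / m : ℝ) + t * I)) = g (ofComplex (x + (m * t : ℝ) * I)) := by
  have hm : (m : ℂ) ≠ 0 := NeZero.ne _
  rw [dilate, coe_ofComplex_add_mul_I ht]
  push_cast
  rw [mul_add, mul_div_cancel₀ _ hm, mul_assoc]

lemma verticalMellin_dilate (m : ℕ) [NeZero m] (α : ℝ) (g : ℍ → ℂ) (x : ℝ) :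
    verticalMellin α (dilate m g) (x / m) = ((m ^ α : ℝ) : ℂ)⁻¹ * verticalMellin α g x := by
  have hm : (0 : ℝ) < m := Nat.cast_pos.2 (NeZero.pos m)
  have hcongr : verticalMellin α (dilate m g) (x / m) =
      mellin (fun t ↦ g (ofComplex (x + (m * t : ℝ) * I))) α :=
    setIntegral_congr_fun measurableSet_Ioi fun t ht ↦ by
      simp only [dilate_vertical m g x ht]
  rw [hcongr, mellin_comp_mul_left (fun t : ℝ ↦ g (ofComplex (x + t * I))) _ hm, smul_eq_mul,
    Complex.cpow_neg, ← Complex.ofReal_cpow hm.le, verticalMellin]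

lemma mellinConvergent_dilate_iff (s : ℂ) (x : ℝ) :
    MellinConvergent (fun t ↦ dilate m g (ofComplex ((x / m : ℝ) + t * I))) s ↔
      MellinConvergent (fun t ↦ g (ofComplex (x + t * I))) s := by
  have hm : (0 : ℝ) < m := Nat.cast_pos.2 (NeZero.pos m)
  rw [← MellinConvergent.comp_mul_left (f := fun t : ℝ ↦ g (ofComplex (x + t * I))) hm]
  refine integrableOn_congr_fun (fun t ht ↦ ?_) measurableSet_Ioi
  simp only [dilate_vertical m g x ht]

lemma IsTwistedForm.tendsto_fracPartialSum
    (h : IsTwistedForm (cuspParam (dilate m g)) β C (dilate m g)) (hα : β < α) (x : ℝ) :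
    Tendsto (fun N ↦ fracPartialSum m g α N x) atTop
      (𝓝 (((2 * π) ^ α / (Real.Gamma α * m ^ α) : ℝ) * verticalMellin α g x)) := by
  have hlim : (((2 * π) ^ α / (Real.Gamma α * m ^ α) : ℝ) : ℂ) * verticalMellin α g x =
      ((2 * π) ^ α / Real.Gamma α : ℝ) * verticalMellin α (dilate m g) (x / m) := by
    rw [verticalMellin_dilate, ← div_div]
    push_cast
    ring
  rw [hlim]
  refine (h.tendsto_fracSum hα (x / m)).congr fun N ↦ ?_
  rw [fracPartialSum]
  refine Finset.sum_congr rfl fun n _ ↦ ?_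
  rw [fourierCoef_eq_twistedCoef h.twist h.holo h.isBoundedAtImInfty_untwist, fourierExp]
  push_cast
  rfl

end FracPartialSum

lemma valueAtInfty_eq_zero {g : ℍ → ℂ} (h : 0 < cuspParam g ∨ fourierCoef g 0 = 0) :
    FracModular.valueAtInfty g = 0 := by
  rw [FracModular.valueAtInfty]
  split_ifs with hκ
  · rfl
  · exact h.resolve_left hκ

lemma smul_infty_eq_coe_iff {γ : SL(2, ℤ)} {x₀ : ℚ} :
    SpecialLinearGroup.mapGL ℚ γ • (OnePoint.infty : OnePoint ℚ) = x₀ ↔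
      γ 1 0 ≠ 0 ∧ x₀ * γ 1 0 = γ 0 0 := by
  rw [OnePoint.smul_infty_eq_ite]
  by_cases hγ : γ 1 0 = 0
  · simp [SpecialLinearGroup.mapGL_coe_matrix, hγ]
  · have hγ' : (γ 1 0 : ℚ) ≠ 0 := Int.cast_ne_zero.2 hγ
    simp [SpecialLinearGroup.mapGL_coe_matrix, hγ, div_eq_iff hγ', eq_comm (b := (γ 0 0 : ℚ))]

lemma IsScalingMatrix.bottom_left_neg_and_smul_infty {Γ : Subgroup SL(2, ℤ)} [Γ.FiniteIndex]
    {x₀ : ℚ} {σ : SL(2, ℝ)} (hσ : IsScalingMatrix Γ x₀ σ) :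
    σ 1 0 < 0 ∧ x₀ * σ 1 0 = σ 0 0 := by
  obtain ⟨γ, hγ, hsign, rfl⟩ := isScalingMatrix_iff.1 hσ
  obtain ⟨hc, hx₀⟩ := smul_infty_eq_coe_iff.1 hγ
  have hfirst (i : Fin 2) : (toReal γ * scalingDiag (cuspWidth Γ x₀)) i 0 =
      γ i 0 * √(cuspWidth Γ x₀ : ℝ) := by
    rw [mul_apply_fin_two]
    simp [toReal_apply, scalingDiag]
  rw [hfirst, hfirst, ← mul_assoc]
  refine ⟨mul_neg_of_neg_of_pos (Int.cast_lt_zero.2 (hsign.resolve_right fun h ↦ hc h.1))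
    (sqrt_natCast_pos _), ?_⟩
  congr 1
  exact_mod_cast hx₀

namespace IsCuspForm

variable {Γ : Subgroup SL(2, ℤ)} [Γ.FiniteIndex] {r : ℝ} {mu : SL(2, ℤ) → ℂ} {f : ℍ → ℂ}
  {𝔞 : OnePoint ℚ} {x₀ : ℚ} {σ : SL(2, ℝ)}

lemma isBigO_atImInfty (hf : IsCuspForm Γ r mu f) (s : ℝ) :
    f =O[atImInfty] fun z ↦ z.im ^ s := by
  set m := cuspWidth Γ OnePoint.infty
  have hm : (0 : ℝ) < m := Nat.cast_pos.2 (NeZero.pos m)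
  obtain ⟨b, -, hdilate⟩ := exists_dilate_eq_const_mul_slash m r f
  have hO : dilate m f =O[atImInfty] fun z ↦ z.im ^ s :=
    hdilate ▸ (hf.isBigO_slash isScalingMatrix_infty s).const_mul_left b
  rw [dilate_eq_comp_scalingDiag] at hO
  have hO' := hO.comp_tendsto (tendsto_inv_scalingDiag_smul m)
  refine IsBigO.trans (hO'.congr_left fun z ↦ ?_) (IsBigO.of_bound ‖((m : ℝ) ^ s)⁻¹‖
    (.of_forall fun z ↦ ?_))
  · rw [Function.comp_apply, smul_inv_smul]
  · have him : z.im = m * ((scalingDiag m)⁻¹ • z).im := by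
      rw [← im_scalingDiag_smul, smul_inv_smul]
    rw [Function.comp_apply, ← norm_mul, him, Real.mul_rpow hm.le (im_pos _).le,
      inv_mul_cancel_left₀ (Real.rpow_pos_of_pos hm s).ne']

lemma integrableOn_eichlerIntegrand (hf : IsCuspForm Γ r mu f) (hσ : IsScalingMatrix Γ x₀ σ)
    {s : ℝ} (hs : 2 ≤ s) (x : ℝ) : IntegrableOn (eichlerIntegrand s f x₀ x) (Set.Ioi 0) := by
  obtain ⟨hσ0, hx₀⟩ := hσ.bottom_left_neg_and_smul_infty
  refine FracModular.integrableOn_eichlerIntegrand hs hf.mdifferentiable (hf.isBigO_atImInfty _)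
    ?_ x
  rw [eq_div_of_mul_eq hσ0.ne hx₀]
  exact isBigO_one_vertical_of_isBigO_slash hσ0.ne (hf.isBigO_slash hσ _)

lemma mellinConvergent_vertical (hf : IsCuspForm Γ r mu f) (hr : 2 < r) (x : ℝ) :
    MellinConvergent (fun t ↦ f (ofComplex (x + t * I))) ((r - 1 : ℝ) : ℂ) := by
  obtain ⟨C, hC⟩ := hf.exists_isTwistedForm_dilate (by linarith)
  exact (mellinConvergent_dilate_iff _ x).1 (hC.mellinConvergent (by linarith) _)

lemma mellinConvergent_slash_vertical (hf : IsCuspForm Γ r mu f) (hr : 2 < r)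
    (hσ : IsScalingMatrix Γ 𝔞 σ) (x : ℝ) :
    MellinConvergent (fun t ↦ slash r σ f (ofComplex (x + t * I))) ((r - 1 : ℝ) : ℂ) := by
  obtain ⟨C, hC⟩ := hf.exists_isTwistedForm_slash (by linarith) hσ
  exact hC.mellinConvergent (by linarith) x

lemma tendsto_fracPartialSum (hf : IsCuspForm Γ r mu f) (hr : 2 < r) (x : ℝ) :
    Tendsto (fun N ↦ fracPartialSum (cuspWidth Γ OnePoint.infty) f (r - 1) N x) atTop
      (𝓝 (((2 * π) ^ (r - 1) / (Real.Gamma (r - 1) *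
        (cuspWidth Γ OnePoint.infty : ℝ) ^ (r - 1)) : ℝ) * verticalMellin (r - 1) f x)) := by
  obtain ⟨C, hC⟩ := hf.exists_isTwistedForm_dilate (by linarith)
  exact hC.tendsto_fracPartialSum (by linarith) x

lemma tendsto_fracPartialSum_slash (hf : IsCuspForm Γ r mu f) (hr : 2 < r)
    (hσ : IsScalingMatrix Γ 𝔞 σ) (x : ℝ) :
    Tendsto (fun N ↦ fracPartialSum 1 (slash r σ f) (r - 1) N x) atTop
      (𝓝 (((2 * π) ^ (r - 1) / Real.Gamma (r - 1) : ℝ) *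
        verticalMellin (r - 1) (slash r σ f) x)) := by
  obtain ⟨C, hC⟩ := hf.exists_isTwistedForm_slash (by linarith) hσ
  rw [← dilate_one (slash r σ f)] at hC
  simpa using hC.tendsto_fracPartialSum (by linarith) x

lemma integral_eichlerIntegrand (hf : IsCuspForm Γ r mu f) (hr : 2 < r)
    (hσ : IsScalingMatrix Γ x₀ σ) (x : ℝ) :
    ∫ t in Set.Ioi 0, eichlerIntegrand r f x₀ x t = I ^ ((r - 1 : ℝ) : ℂ) *
      (verticalMellin (r - 1) f x - kernelFactor r (σ 1 0) (x - x₀) *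
        verticalMellin (r - 1) (slash r σ f) (moebius σ⁻¹ x)) := by
  rcases eq_or_ne x x₀ with rfl | hx
  · rw [integral_eichlerIntegrand_self, sub_self, kernelFactor, abs_zero,
      Real.zero_rpow (by linarith), Complex.ofReal_zero, zero_mul, mul_zero, zero_mul, sub_zero]
  obtain ⟨hσ0, hx₀⟩ := hσ.bottom_left_neg_and_smul_infty
  obtain ⟨C, hC⟩ := hf.exists_norm_mul_im_rpow_le
  have hC' (z : ℍ) : ‖f z‖ ≤ C * z.im ^ (-(r / 2)) := by
    rw [Real.rpow_neg z.im_pos.le, ← div_eq_mul_inv, le_div_iff₀ (Real.rpow_pos_of_pos z.im_pos _)]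
    exact hC z
  rw [integral_eichlerIntegrand_eq_sub hr hf.mdifferentiable hC' (hf.isBigO_atImInfty _) hσ0
    (hf.isBigO_slash hσ _) hx₀ hx
    (integrableOn_eichlerIntegrand_self (hf.mellinConvergent_vertical hr x))
    (integrableOn_eichlerIntegrand_self (hf.mellinConvergent_slash_vertical hr hσ _)),
    integral_eichlerIntegrand_self, integral_eichlerIntegrand_self]
  ring

/- Here `A = 1` is arbitrary, since `f(x₀) = 0`. -/
lemma approxError_eq_periodIntegral (hf : IsCuspForm Γ r mu f) (hr : 2 < r)
    (hσ : IsScalingMatrix Γ x₀ σ) (x : ℝ) :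
    approxError Γ r (r - 1) f x₀ σ 1
        (|σ 1 0| ^ (r - 2) / (cuspWidth Γ OnePoint.infty : ℝ) ^ (r - 1)) x =
      periodIntegral (cuspWidth Γ OnePoint.infty) r f x₀ x := by
  set m := cuspWidth Γ OnePoint.infty
  have hm : (0 : ℝ) < m := Nat.cast_pos.2 (NeZero.pos m)
  have hm' : ((m ^ (r - 1) : ℝ) : ℂ) ≠ 0 :=
    Complex.ofReal_ne_zero.2 (Real.rpow_pos_of_pos hm _).ne'
  have hΓ : (Real.Gamma (r - 1) : ℂ) ≠ 0 :=
    Complex.ofReal_ne_zero.2 (Real.Gamma_pos_of_pos (by linarith)).ne'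
  have hIm : (I * m) ^ ((r - 1 : ℝ) : ℂ) = ((m ^ (r - 1) : ℝ) : ℂ) * I ^ ((r - 1 : ℝ) : ℂ) := by
    rw [mul_comm, ← Complex.ofReal_natCast, ofReal_mul_cpow hm Complex.I_ne_zero,
      Complex.ofReal_cpow hm.le]
  have hfrac : fracIntegral m f (r - 1) x =
      ((2 * π) ^ (r - 1) / (Real.Gamma (r - 1) * m ^ (r - 1)) : ℝ) * verticalMellin (r - 1) f x :=
    (hf.tendsto_fracPartialSum hr x).limUnder_eq
  have hfrac' : fracIntegral 1 (slash r σ f) (r - 1) (moebius σ⁻¹ x) = _ :=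
    (hf.tendsto_fracPartialSum_slash hr hσ _).limUnder_eq
  rw [approxError, valueAtInfty_eq_zero (hf.cuspidal _ σ hσ), hfrac, hfrac', periodIntegral, hIm,
    hf.integral_eichlerIntegrand hr hσ, kernelFactor]
  push_cast at hm' ⊢
  field_simp
  ring

end IsCuspForm

lemma exists_polynomial_periodIntegral (m : ℕ) {f : ℍ → ℂ} {x₀ : ℝ} (n : ℕ)
    (hint : ∀ k ≤ n, IntegrableOn (eichlerIntegrand (k + 2) f x₀ 0) (Set.Ioi 0)) :
    ∃ P : Polynomial ℂ, P.natDegree ≤ n ∧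
      ∀ x : ℝ, periodIntegral m (n + 2) f x₀ x = P.eval (x : ℂ) := by
  set c : ℂ := ((2 * π) ^ ((n : ℝ) + 2 - 1) : ℝ) /
    ((I * m) ^ (((n : ℝ) + 2 - 1 : ℝ) : ℂ) * (Real.Gamma (n + 2 - 1) : ℝ))
  have hkernel (k : ℕ) (y t : ℝ) : eichlerIntegrand (k + 2) f x₀ y t =
      ((x₀ + t * I) - y : ℂ) ^ k * f (ofComplex (x₀ + t * I)) * I := by
    rw [eichlerIntegrand, add_sub_cancel_right, Complex.ofReal_natCast, Complex.cpow_natCast]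
  have hbinom (x t : ℝ) : eichlerIntegrand (n + 2) f x₀ x t = ∑ k ∈ Finset.range (n + 1),
      eichlerIntegrand (k + 2) f x₀ 0 t * ((-x) ^ (n - k) * n.choose k : ℂ) := by
    rw [hkernel, sub_eq_add_neg, add_pow, Finset.sum_mul, Finset.sum_mul]
    refine Finset.sum_congr rfl fun k _ ↦ ?_
    rw [hkernel, Complex.ofReal_zero, sub_zero]
    ring
  refine ⟨∑ k ∈ Finset.range (n + 1), Polynomial.C (c * (∫ t in Set.Ioi 0,
    eichlerIntegrand (k + 2) f x₀ 0 t) * (-1) ^ (n - k) * n.choose k) * Polynomial.X ^ (n - k),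
    Polynomial.natDegree_sum_le_of_forall_le _ _ fun k _ ↦
      (Polynomial.natDegree_C_mul_X_pow_le _ _).trans (Nat.sub_le n k), fun x ↦ ?_⟩
  simp_rw [periodIntegral, hbinom]
  rw [integral_finsetSum _ fun k hk ↦
      (hint k (Finset.mem_range_succ_iff.1 hk)).mul_const _, Polynomial.eval_finsetSum,
    Finset.mul_sum]
  refine Finset.sum_congr rfl fun k _ ↦ ?_
  rw [integral_mul_const, Polynomial.eval_C_mul, Polynomial.eval_pow, Polynomial.eval_X, neg_pow]
  ring

lemma IsCuspForm.exists_polynomial_periodIntegral {Γ : Subgroup SL(2, ℤ)} [Γ.FiniteIndex] {r : ℝ}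
    {mu : SL(2, ℤ) → ℂ} {f : ℍ → ℂ} (hf : IsCuspForm Γ r mu f) (hr : 2 ≤ r) (hr' : ∃ k : ℤ, r = k)
    {x₀ : ℚ} {σ : SL(2, ℝ)} (hσ : IsScalingMatrix Γ x₀ σ) (m : ℕ) :
    ∃ P : Polynomial ℂ, (P.natDegree : ℝ) ≤ r - 2 ∧
      ∀ x : ℝ, periodIntegral m r f x₀ x = P.eval (x : ℂ) := by
  obtain ⟨k, rfl⟩ := hr'
  obtain ⟨n, rfl⟩ := Int.le.dest (a := 2) (b := k) (by exact_mod_cast hr)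
  obtain ⟨P, hdeg, hP⟩ := FracModular.exists_polynomial_periodIntegral m n fun j _ ↦
    hf.integrableOn_eichlerIntegrand hσ (s := j + 2) (by simp) 0
  have hweight : ((2 + n : ℤ) : ℝ) = n + 2 := by
    push_cast
    ring
  rw [hweight, add_sub_cancel_right]
  exact ⟨P, Nat.cast_le.2 hdeg, hP⟩

end FracModular

end

theorem corollary2p5 (Γ : Subgroup SL(2, ℤ)) (hΓ : Γ.FiniteIndex) (r : ℝ) (hr : 2 < r)
    (mu : SL(2, ℤ) → ℂ) (f : UpperHalfPlane → ℂ) (hf : FracModular.IsCuspForm Γ r mu f)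
    (x₀ : ℚ) (σ : SL(2, ℝ)) (hσ : FracModular.IsScalingMatrix Γ (x₀ : OnePoint ℚ) σ) :
    -- the series defining `f_α` and `f_α^σ`, `α = r - 1`, converge on the real line
    (∀ x : ℝ, ∃ s : ℂ, Filter.Tendsto
      (fun N : ℕ => FracModular.fracPartialSum
        (FracModular.cuspWidth Γ OnePoint.infty) f (r - 1) N x) Filter.atTop (nhds s)) ∧
    (∀ x : ℝ, ∃ s : ℂ, Filter.Tendsto
      (fun N : ℕ => FracModular.fracPartialSum 1 (FracModular.slash r σ f) (r - 1) N x)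
      Filter.atTop (nhds s)) ∧
    -- the integral converges absolutely
    (∀ x : ℝ, MeasureTheory.IntegrableOn (FracModular.eichlerIntegrand r f x₀ x)
      (Set.Ioi 0)) ∧
    ∃ A B : ℝ, A ≠ 0 ∧ 0 < B ∧
      (∀ x : ℝ, FracModular.approxError Γ r (r - 1) f x₀ σ A B x =
        FracModular.periodIntegral (FracModular.cuspWidth Γ OnePoint.infty) r f x₀ x) ∧
      ((∃ k : ℤ, r = k) → ∃ P : Polynomial ℂ, (P.natDegree : ℝ) ≤ r - 2 ∧
        ∀ x : ℝ, FracModular.approxError Γ r (r - 1) f x₀ σ A B x = P.eval (x : ℂ)) := by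
  have : Γ.FiniteIndex := hΓ
  have hB : 0 < |σ 1 0| ^ (r - 2) / (FracModular.cuspWidth Γ OnePoint.infty : ℝ) ^ (r - 1) := by
    have hσ0 : 0 < |σ 1 0| := abs_pos.2 hσ.bottom_left_neg_and_smul_infty.1.ne
    have hm : 0 < FracModular.cuspWidth Γ OnePoint.infty := NeZero.pos _
    positivity
  have hE := hf.approxError_eq_periodIntegral hr hσ
  refine ⟨fun x ↦ ⟨_, hf.tendsto_fracPartialSum hr x⟩,
    fun x ↦ ⟨_, hf.tendsto_fracPartialSum_slash hr hσ x⟩,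
    hf.integrableOn_eichlerIntegrand hσ hr.le, 1, _, one_ne_zero, hB, hE, fun hk ↦ ?_⟩
  obtain ⟨P, hdeg, hP⟩ := hf.exists_polynomial_periodIntegral hr.le hk hσ _
  exact ⟨P, hdeg, fun x ↦ (hE x).trans (hP x)⟩
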